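/- Let $k\in\mathbb Z\setminus\{0\}$, $\mu_a\in\mathbb R$, and let $V\in C^1((0,+\infty))$ be a real-valued, strictly increasing function with $V<0$ on $(0,+\infty)$. Assume the following. (i) (Behaviour at $+\infty$.) There are $\gamma_\infty<0$ and $\alpha_\infty\in(0,1]$ such that $R_{V,\infty}(x):=V(x)-\gamma_\infty x^{-\alpha_\infty}$ satisfies $x^{\alpha_\infty}R_{V,\infty}(x)\to0$ and $x^{\alpha_\infty+1}R_{V,\infty}'(x)\to0$ as $x\to+\infty$. (ii) (Behaviour at $0$.) There are $\gamma_0\in\mathbb R$ and $\alpha_0>0$ such that, with $R_{V,0}(x):=V(x)-\gamma_0x^{-\alpha_0}$: - if $\mu_a=0$, then $\alpha_0=1$, $xR_{V,0}(x)\to0$ as $x\to0^+$, $\int_0^1\frac1x|xR_{V,0}(x)|^{q'}\,dx<+\infty$ for some $q'\ge1$, and $\gamma_0^2<k^2-\frac14$; - if $\mu_a\ne0$, then $x^{\alpha_0}R_{V,0}(x)\to0$ and $x^{\alpha_0+1}R_{V,0}'(x)\to0$ as $x\to0^+$, $\int_0^1 x^{-\alpha_0-1}|x^{\alpha_0+1}R_{V,0}'(x)|^{q''}\,dx<+\infty$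 for some $q''\ge1$, and $\gamma_0\neq0$. For $x>0$ set $$P(x)=\begin{pmatrix}-1+V(x)&-\frac kx-\mu_aV'(x)\\-\frac kx-\mu_aV'(x)&1+V(x)\end{pmatrix},\qquad J=\begin{pmatrix}0&1\\-1&0\end{pmatrix},\qquad \tau z=Jz'+P(x)z,$$ and let $A_0$ be the operator in $L^2((0,+\infty);\mathbb R^2)$ with domain $$D(A_0)=\{z\in L^2(0,+\infty):\ z \text{ is locally absolutely continuous on }(0,+\infty),\ \tau z\in L^2(0,+\infty)\},\qquad A_0z=\tau z.$$ Then there is a sequence $(\lambda_n)_{n\in\mathbb N}$ of eigenvalues of $A_0$ with $\lambda_n\in(-1,1)$ for every $n$ and $\lambda_n\to1$ as $n\to\infty$. -/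

import Mathlib

open MeasureTheory Set Filter Topology

namespace RadialDirac

/-- The symplectic matrix `J`. -/
def J : Matrix (Fin 2) (Fin 2) ℝ := !![0, 1; -1, 0]

/-- The radial Dirac matrix `P_{V,k,μ}(x)` with electrostatic potential `V`, angular momentum
number `k` and anomalous magnetic moment `μ`. -/
noncomputable def diracMatrix (V : ℝ → ℝ) (k : ℤ) (μ : ℝ) (x : ℝ) : Matrix (Fin 2) (Fin 2) ℝ :=
  !![-1 + V x, -(k : ℝ) / x - μ * deriv V x;
     -(k : ℝ) / x - μ * deriv V x, 1 + V x]

/-- The measure on the half line `(0, +∞)`. -/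
noncomputable abbrev halfLine : Measure ℝ := volume.restrict (Ioi (0 : ℝ))

/-- The Hilbert space `L²((0, +∞); ℝ²)`. -/
noncomputable abbrev L2HalfLine : Type := Lp (EuclideanSpace ℝ (Fin 2)) 2 halfLine

/-- `u` is locally absolutely continuous on `(0, +∞)`: absolutely continuous on every compact
interval `[a, b] ⊆ (0, +∞)`. -/
def IsLocAC (u : ℝ → ℝ) : Prop :=
  ∀ a b : ℝ, 0 < a → a ≤ b → AbsolutelyContinuousOnInterval u a b

/-- The function `z = (u, v)`. -/
def pair (u v : ℝ → ℝ) (x : ℝ) : EuclideanSpace ℝ (Fin 2) := !₂[u x, v x]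

/-- The formal differential expression `τ z = J z' + P(x) z`, for `z = (u, v)`. -/
noncomputable def tau (P : ℝ → Matrix (Fin 2) (Fin 2) ℝ) (u v : ℝ → ℝ) (x : ℝ) :
    EuclideanSpace ℝ (Fin 2) :=
  WithLp.toLp 2 (Matrix.mulVec J ![deriv u x, deriv v x] + Matrix.mulVec (P x) ![u x, v x])

theorem tau_zero (P : ℝ → Matrix (Fin 2) (Fin 2) ℝ) (u v : ℝ → ℝ) (x : ℝ) :
    tau P u v x 0 = deriv v x + (P x 0 0 * u x + P x 0 1 * v x) := by
  simp [tau, J, dotProduct, Fin.sum_univ_two, -Matrix.mulVec_cons]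

theorem tau_one (P : ℝ → Matrix (Fin 2) (Fin 2) ℝ) (u v : ℝ → ℝ) (x : ℝ) :
    tau P u v x 1 = -deriv u x + (P x 1 0 * u x + P x 1 1 * v x) := by
  simp [tau, J, dotProduct, Fin.sum_univ_two, -Matrix.mulVec_cons]

theorem IsLocAC.continuousOn {u : ℝ → ℝ} (hu : IsLocAC u) : ContinuousOn u (Ioi 0) := by
  intro x hx
  have hx0 : (0 : ℝ) < x := hx
  have h := (hu (x / 2) (x + 1) (by linarith) (by linarith)).continuousOn
  rw [uIcc_of_le (by linarith)] at h
  exact (h.continuousAt (Icc_mem_nhds (by linarith) (by linarith))).continuousWithinAt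

theorem IsLocAC.ae_differentiableAt {u : ℝ → ℝ} (hu : IsLocAC u) :
    ∀ᵐ x ∂halfLine, DifferentiableAt ℝ u x := by
  rw [ae_restrict_iff' measurableSet_Ioi]
  have h : ∀ n : ℕ, ∀ᵐ x, x ∈ uIcc (1 / ((n : ℝ) + 1)) ((n : ℝ) + 1) →
      DifferentiableAt ℝ u x := fun n =>
    (hu (1 / ((n : ℝ) + 1)) ((n : ℝ) + 1) (by positivity) (by
      rw [div_le_iff₀ (by positivity)]; nlinarith [(n.cast_nonneg : (0 : ℝ) ≤ n)])).ae_differentiableAt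
  filter_upwards [ae_all_iff.2 h] with x hx hx0
  have hx0' : (0 : ℝ) < x := hx0
  obtain ⟨n, hn⟩ := exists_nat_gt (max x (1 / x))
  have h1 : x < n := lt_of_le_of_lt (le_max_left _ _) hn
  have h2 : 1 / x < n := lt_of_le_of_lt (le_max_right _ _) hn
  refine hx n (Icc_subset_uIcc ⟨?_, by linarith⟩)
  rw [div_le_iff₀ (by positivity)]
  rw [div_lt_iff₀ hx0'] at h2
  nlinarith

/-- The graph of the operator `A₀` in `L² × L²`: the pairs `(f, g)` such that `f` has a locally
absolutely continuous representative `z = (u, v)` and `g = τ z`. -/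
noncomputable def graphA0 (P : ℝ → Matrix (Fin 2) (Fin 2) ℝ) :
    Submodule ℝ (L2HalfLine × L2HalfLine) where
  carrier := {p | ∃ u v : ℝ → ℝ, IsLocAC u ∧ IsLocAC v ∧
    p.1 =ᵐ[halfLine] pair u v ∧ p.2 =ᵐ[halfLine] tau P u v}
  zero_mem' := by
    have h0 : IsLocAC (fun _ : ℝ => (0 : ℝ)) := fun a b _ _ => by
      simpa using (LipschitzOnWith.absolutelyContinuousOnInterval
        ((LipschitzWith.const (0 : ℝ)).lipschitzOnWith (s := uIcc a b)))
    refine ⟨fun _ => 0, fun _ => 0, h0, h0, ?_, ?_⟩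
    · filter_upwards [Lp.coeFn_zero (EuclideanSpace ℝ (Fin 2)) 2 halfLine] with x hx
      rw [Prod.fst_zero, hx]
      ext i; fin_cases i <;> simp [pair]
    · filter_upwards [Lp.coeFn_zero (EuclideanSpace ℝ (Fin 2)) 2 halfLine] with x hx
      rw [Prod.snd_zero, hx]
      ext i; fin_cases i <;> simp [tau_zero, tau_one]
  add_mem' := by
    rintro ⟨f, g⟩ ⟨f', g'⟩ ⟨u, v, hu, hv, hf, hg⟩ ⟨u', v', hu', hv', hf', hg'⟩
    refine ⟨u + u', v + v', fun a b ha hb => (hu a b ha hb).add (hu' a b ha hb),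
      fun a b ha hb => (hv a b ha hb).add (hv' a b ha hb), ?_, ?_⟩
    · filter_upwards [Lp.coeFn_add f f', hf, hf'] with x hx h1 h2
      simp only [Prod.mk_add_mk] at h1 h2 ⊢
      rw [hx, Pi.add_apply, h1, h2]
      ext i; fin_cases i <;> simp [pair]
    · filter_upwards [Lp.coeFn_add g g', hg, hg', hu.ae_differentiableAt, hv.ae_differentiableAt,
        hu'.ae_differentiableAt, hv'.ae_differentiableAt] with x hx h1 h2 d1 d2 d3 d4
      simp only [Prod.mk_add_mk] at h1 h2 ⊢
      rw [hx, Pi.add_apply, h1, h2]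
      ext i; fin_cases i <;>
        simp [tau_zero, tau_one, deriv_add d1 d3, deriv_add d2 d4] <;> ring
  smul_mem' := by
    rintro c ⟨f, g⟩ ⟨u, v, hu, hv, hf, hg⟩
    refine ⟨fun x => c * u x, fun x => c * v x, fun a b ha hb => (hu a b ha hb).const_mul c,
      fun a b ha hb => (hv a b ha hb).const_mul c, ?_, ?_⟩
    · filter_upwards [Lp.coeFn_smul c f, hf] with x hx h1
      simp only [Prod.smul_mk] at h1 ⊢
      rw [hx, Pi.smul_apply, h1]
      ext i; fin_cases i <;> simp [pair]
    · filter_upwards [Lp.coeFn_smul c g, hg, hu.ae_differentiableAt,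
        hv.ae_differentiableAt] with x hx h1 d1 d2
      simp only [Prod.smul_mk] at h1 ⊢
      rw [hx, Pi.smul_apply, h1]
      ext i; fin_cases i <;>
        simp [tau_zero, tau_one, deriv_const_mul c d1, deriv_const_mul c d2] <;> ring

theorem eqOn_zero_of_ae {u : ℝ → ℝ} (hu : IsLocAC u) (h : u =ᵐ[halfLine] fun _ => 0) :
    ∀ x ∈ Ioi (0 : ℝ), u x = 0 := by
  have := MeasureTheory.Measure.eqOn_open_of_ae_eq h isOpen_Ioi hu.continuousOn continuousOn_const
  exact fun x hx => this hx

/-- `graphA0` is the graph of a function: `τ z` depends only on the class of `z` in `L²`. -/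
theorem graphA0_single_valued (P : ℝ → Matrix (Fin 2) (Fin 2) ℝ)
    (p : L2HalfLine × L2HalfLine) (hp : p ∈ graphA0 P) (h0 : p.1 = 0) : p.2 = 0 := by
  obtain ⟨u, v, hu, hv, hf, hg⟩ := hp
  have hz := Lp.coeFn_zero (EuclideanSpace ℝ (Fin 2)) 2 halfLine
  rw [h0] at hf
  have hu0 := eqOn_zero_of_ae hu (by
    filter_upwards [hf, hz] with x h1 h2
    have := congrArg (fun w : EuclideanSpace ℝ (Fin 2) => w 0) (h1.symm.trans h2)
    simpa [pair] using this)
  have hv0 := eqOn_zero_of_ae hv (by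
    filter_upwards [hf, hz] with x h1 h2
    have := congrArg (fun w : EuclideanSpace ℝ (Fin 2) => w 1) (h1.symm.trans h2)
    simpa [pair] using this)
  have hd : ∀ w : ℝ → ℝ, (∀ x ∈ Ioi (0 : ℝ), w x = 0) → ∀ x ∈ Ioi (0 : ℝ), deriv w x = 0 := by
    intro w hw x hx
    have : w =ᶠ[𝓝 x] fun _ => 0 := by
      filter_upwards [isOpen_Ioi.mem_nhds hx] with y hy using hw y hy
    rw [this.deriv_eq]; simp
  apply Lp.ext
  filter_upwards [hg, hz, ae_restrict_mem measurableSet_Ioi] with x h1 h2 hx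
  rw [h1, h2]
  ext i; fin_cases i <;>
    simp [tau_zero, tau_one, hu0 x hx, hv0 x hx, hd u hu0 x hx, hd v hv0 x hx]

/-- The operator `A₀` in `L²((0, +∞); ℝ²)`: its domain consists of the `z ∈ L²` that are locally
absolutely continuous on `(0, +∞)` and satisfy `τ z ∈ L²`, and `A₀ z = τ z`. -/
noncomputable def A0 (P : ℝ → Matrix (Fin 2) (Fin 2) ℝ) : L2HalfLine →ₗ.[ℝ] L2HalfLine :=
  (graphA0 P).toLinearPMap

theorem A0_graph (P : ℝ → Matrix (Fin 2) (Fin 2) ℝ) : (A0 P).graph = graphA0 P :=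
  Submodule.toLinearPMap_graph_eq _ (fun p hp h => graphA0_single_valued P p hp h)

/-- `lam` is an eigenvalue of the (unbounded) operator `A`. -/
def IsEigenvalue {H : Type*} [AddCommGroup H] [Module ℝ H] (A : H →ₗ.[ℝ] H) (lam : ℝ) : Prop :=
  ∃ f : A.domain, (f : H) ≠ 0 ∧ A f = lam • (f : H)

/-- The remainder `R(x) = V(x) - γ / x ^ α`. -/
noncomputable def remainder (V : ℝ → ℝ) (γ α : ℝ) (x : ℝ) : ℝ := V x - γ / x ^ α

/-- The condition on `V` at `+∞`: `V = γ / x ^ α + R` with `x ^ α R = o(1)` and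
`x ^ (α + 1) R' = o(1)`. -/
def ConditionAtInfinity (V : ℝ → ℝ) (γ α : ℝ) : Prop :=
  0 < α ∧
  Tendsto (fun x => x ^ α * remainder V γ α x) atTop (𝓝 0) ∧
  Tendsto (fun x => x ^ (α + 1) * deriv (remainder V γ α) x) atTop (𝓝 0)

/-- The condition on `V = γ / x ^ α + R` at `0`, for the two cases `μ = 0` and `μ ≠ 0`. -/
def ConditionAtZero (V : ℝ → ℝ) (k : ℤ) (μ γ α : ℝ) : Prop :=
  0 < α ∧
  (μ = 0 →
    α = 1 ∧
    Tendsto (fun x => x * remainder V γ α x) (𝓝[>] 0) (𝓝 0) ∧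
    (∃ q : ℝ, 1 ≤ q ∧
      IntegrableOn (fun x => 1 / x * |x * remainder V γ α x| ^ q) (Ioo 0 1)) ∧
    γ ^ 2 < (k : ℝ) ^ 2 - 1 / 4) ∧
  (μ ≠ 0 →
    Tendsto (fun x => x ^ α * remainder V γ α x) (𝓝[>] 0) (𝓝 0) ∧
    Tendsto (fun x => x ^ (α + 1) * deriv (remainder V γ α) x) (𝓝[>] 0) (𝓝 0) ∧
    (∃ q : ℝ, 1 ≤ q ∧
      IntegrableOn (fun x => 1 / x ^ (α + 1) *
        |x ^ (α + 1) * deriv (remainder V γ α) x| ^ q) (Ioo 0 1)) ∧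
    γ ≠ 0)

end RadialDirac

/-! In the variable `x = exp t`, write a solution of `τ z = lam z` as `exp ℓ • (cos θ, sin θ)`. The
system splits into a scalar equation for the angle, `θ' = exp t * (lam + cos 2θ) + q - b * sin 2θ`,
with `q = -x V > 0` and `b = -k - μ x V'`, and a quadrature `ℓ' = b * cos 2θ + exp t * sin 2θ`.
Square integrability can then be read off the angle.

At `t → -∞` the term `b` has constant sign, is bounded away from `0` and dominates `q`. One
direction attracts forward in time and has `b * cos 2θ > 0`; a solution that stays near it all the
way to `-∞` has bounded amplitude near `x = 0`. At `t → +∞` the factor `exp t` dominates, and the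
direction with `cos 2θ` near `-lam` and `sin 2θ < 0` repels forward in time; a solution that stays
near it decays exponentially in `x`. `exists_left_family` and `exists_right_family` construct both
kinds of solution, continuously in `lam`; call their angles `θ` and `ψ`. By
`isEigenvalue_of_isAngle`, `lam` is an eigenvalue as soon as the two agree at one time modulo `π`.

Because `αinf ≤ 1`, `q` stays above a positive constant at infinity. At `lam = 1` the angular
velocity is therefore eventually bounded below for every angle (`exists_pos_le_angleField_one`), so
for `lam` close to `1` the left angle turns arbitrarily far while the right one stays below `0`.
Hence `θ - ψ` at a fixed time exceeds a prescribed multiple of `π`, and the intermediate value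
theorem gives an eigenvalue in every `[l, 1)` (`exists_connecting_angle`). -/

namespace RadialDirac

/-! ### The Prüfer angle equation -/

/-- The right-hand side of the equation for the Prüfer angle. -/
noncomputable def angleField (a q b : ℝ → ℝ) (lam t θ : ℝ) : ℝ :=
  a t * (lam + Real.cos (2 * θ)) + q t - b t * Real.sin (2 * θ)

/-- `θ` is a global solution of the equation for the Prüfer angle. -/
def IsAngle (a q b : ℝ → ℝ) (lam : ℝ) (θ : ℝ → ℝ) : Prop :=
  ∀ t, HasDerivAt θ (angleField a q b lam t (θ t)) t

variable {a q b : ℝ → ℝ} {lam lam' : ℝ} {θ θ' : ℝ → ℝ}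

theorem IsAngle.continuous (h : IsAngle a q b lam θ) : Continuous θ :=
  continuous_iff_continuousAt.2 fun t => (h t).continuousAt

theorem abs_angleField_sub_le (a q b : ℝ → ℝ) (lam lam' t x y : ℝ) :
    |angleField a q b lam t x - angleField a q b lam' t y| ≤
      |a t| * |lam - lam'| + 2 * (|a t| + |b t|) * |x - y| := by
  have hc : |Real.cos (2 * x) - Real.cos (2 * y)| ≤ 2 * |x - y| := by
    refine (Real.abs_cos_sub_cos_le _ _).trans_eq ?_
    rw [← mul_sub, abs_mul, abs_two]
  have hs : |Real.sin (2 * x) - Real.sin (2 * y)| ≤ 2 * |x - y| := by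
    refine (Real.abs_sin_sub_sin_le _ _).trans_eq ?_
    rw [← mul_sub, abs_mul, abs_two]
  have e : angleField a q b lam t x - angleField a q b lam' t y =
      a t * (lam - lam') + (a t * (Real.cos (2 * x) - Real.cos (2 * y)) -
        b t * (Real.sin (2 * x) - Real.sin (2 * y))) := by
    unfold angleField; ring
  rw [e]
  refine (abs_add_le _ _).trans ?_
  rw [abs_mul]
  have h2 := abs_sub (a t * (Real.cos (2 * x) - Real.cos (2 * y)))
    (b t * (Real.sin (2 * x) - Real.sin (2 * y)))
  rw [abs_mul, abs_mul] at h2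
  have h3 := mul_le_mul_of_nonneg_left hc (abs_nonneg (a t))
  have h4 := mul_le_mul_of_nonneg_left hs (abs_nonneg (b t))
  nlinarith

theorem abs_angleField_le (a q b : ℝ → ℝ) (lam t x : ℝ) :
    |angleField a q b lam t x| ≤ |a t| * (|lam| + 1) + |q t| + |b t| := by
  unfold angleField
  refine (abs_sub _ _).trans (add_le_add ((abs_add_le _ _).trans (add_le_add ?_ le_rfl)) ?_)
  · rw [abs_mul]
    exact mul_le_mul_of_nonneg_left
      ((abs_add_le _ _).trans (add_le_add le_rfl (Real.abs_cos_le_one _))) (abs_nonneg _)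
  · rw [abs_mul]
    exact mul_le_of_le_one_right (abs_nonneg _) (Real.abs_sin_le_one _)

theorem exists_bound_on_ball (ha : Continuous a) (hq : Continuous q) (hb : Continuous b)
    (s N : ℝ) :
    ∃ C : ℝ, 0 ≤ C ∧ ∀ t, |t - s| ≤ N → |a t| ≤ C ∧ |q t| ≤ C ∧ |b t| ≤ C := by
  have hc : Continuous fun t => |a t| + |q t| + |b t| := by fun_prop
  obtain ⟨C, hC⟩ := (isCompact_Icc (a := s - N) (b := s + N)).bddAbove_image hc.continuousOn
  refine ⟨max C 0, le_max_right _ _, fun t ht => ?_⟩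
  have h := hC (mem_image_of_mem _ (show t ∈ Icc (s - N) (s + N) by
    rw [abs_le] at ht; constructor <;> linarith))
  have h1 := abs_nonneg (a t)
  have h2 := abs_nonneg (q t)
  have h3 := abs_nonneg (b t)
  have h4 := le_max_left C 0
  have h5 : |a t| + |q t| + |b t| ≤ C := h
  refine ⟨?_, ?_, ?_⟩ <;> linarith

/-- A two-sided Grönwall inequality. -/
theorem le_mul_exp_of_abs_deriv_le {h h' : ℝ → ℝ} {K s N : ℝ} (hd : ∀ t, HasDerivAt h (h' t) t)
    (hb : ∀ t, |t - s| ≤ N → |h' t| ≤ K * h t) {t : ℝ} (ht : |t - s| ≤ N) :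
    h t ≤ h s * Real.exp (K * |t - s|) := by
  have hN : 0 ≤ N := (abs_nonneg _).trans ht
  have hexp : ∀ c u : ℝ, HasDerivAt (fun u => h u * Real.exp (c * u))
      ((h' u + c * h u) * Real.exp (c * u)) u := fun c u => by
    have h1 : HasDerivAt (fun u => Real.exp (c * u)) (Real.exp (c * u) * c) u := by
      simpa using ((hasDerivAt_id u).const_mul c).exp
    exact ((hd u).mul h1).congr_deriv (by ring)
  have hcont : ∀ c, Continuous (fun u => h u * Real.exp (c * u)) := fun c =>
    continuous_iff_continuousAt.2 fun u => (hexp c u).continuousAt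
  have key : ∀ c d : ℝ, h t * Real.exp (c * t) ≤ h s * Real.exp (c * s) → c * s - c * t = d →
      h t ≤ h s * Real.exp d := by
    intro c d h1 h2
    have h3 : h t = h t * Real.exp (c * t) * Real.exp (-(c * t)) := by
      rw [mul_assoc, ← Real.exp_add]; simp
    rw [h3, ← h2, sub_eq_add_neg, Real.exp_add, ← mul_assoc]
    exact mul_le_mul_of_nonneg_right h1 (Real.exp_pos _).le
  rcases le_total s t with hst | hst
  · have := antitoneOn_of_deriv_nonpos (convex_Icc s t) (hcont (-K)).continuousOn
      (fun u _ => (hexp (-K) u).differentiableAt.differentiableWithinAt) (fun u hu => by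
        rw [interior_Icc] at hu
        rw [(hexp (-K) u).deriv]
        have h1 := hb u (by
          rw [abs_of_nonneg (by linarith [hu.1])]
          rw [abs_of_nonneg (by linarith)] at ht
          linarith [hu.2])
        exact mul_nonpos_of_nonpos_of_nonneg (by linarith [le_abs_self (h' u)])
          (Real.exp_pos _).le)
    refine key (-K) _ (this (left_mem_Icc.2 hst) (right_mem_Icc.2 hst) hst) ?_
    rw [abs_of_nonneg (by linarith)]; ring
  · have := monotoneOn_of_deriv_nonneg (convex_Icc t s) (hcont K).continuousOn
      (fun u _ => (hexp K u).differentiableAt.differentiableWithinAt) (fun u hu => by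
        rw [interior_Icc] at hu
        rw [(hexp K u).deriv]
        have h1 := hb u (by
          rw [abs_of_nonpos (by linarith [hu.2])]
          rw [abs_of_nonpos (by linarith)] at ht
          linarith [hu.1])
        exact mul_nonneg (by linarith [neg_abs_le (h' u)]) (Real.exp_pos _).le)
    refine key K _ (this (left_mem_Icc.2 hst) (right_mem_Icc.2 hst) hst) ?_
    rw [abs_of_nonpos (by linarith)]; ring

/-- Continuous dependence of the angle on the initial value and on the spectral parameter. -/
theorem exists_sq_sub_le (ha : Continuous a) (hq : Continuous q) (hb : Continuous b)
    (s t : ℝ) : ∃ C : ℝ, 0 ≤ C ∧ ∀ lam lam' θ θ', IsAngle a q b lam θ → IsAngle a q b lam' θ' →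
      (θ t - θ' t) ^ 2 ≤ C * ((θ s - θ' s) ^ 2 + (lam - lam') ^ 2) := by
  obtain ⟨C, hC0, hC⟩ := exists_bound_on_ball ha hq hb s |t - s|
  -- With `w` the difference of the angles, the derivative of `w ^ 2` is at most `2|w| (C |lam -
  -- lam'| + 4 C |w|)`. The first product costs `C w ^ 2 + C (lam - lam') ^ 2`, whence `9 = 8 + 1`.
  -- Adding the constant `(lam - lam') ^ 2` makes the estimate homogeneous.
  refine ⟨Real.exp (9 * C * |t - s|), (Real.exp_pos _).le, fun lam lam' θ θ' h h' => ?_⟩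
  have := le_mul_exp_of_abs_deriv_le (h := fun u => (θ u - θ' u) ^ 2 + (lam - lam') ^ 2)
    (h' := fun u => 2 * (θ u - θ' u) *
      (angleField a q b lam u (θ u) - angleField a q b lam' u (θ' u)))
    (K := 9 * C) (s := s) (N := |t - s|) (t := t) (fun u => by
      have := (((h u).sub (h' u)).pow 2).add_const ((lam - lam') ^ 2)
      exact this.congr_deriv (by simp)) (fun u hu => by
      obtain ⟨h1, -, h3⟩ := hC u hu
      have h4 := abs_angleField_sub_le a q b lam lam' u (θ u) (θ' u)
      have hw := abs_nonneg (θ u - θ' u)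
      have hl := abs_nonneg (lam - lam')
      have h5 : |angleField a q b lam u (θ u) - angleField a q b lam' u (θ' u)| ≤
          C * |lam - lam'| + 4 * C * |θ u - θ' u| := by
        refine h4.trans (add_le_add (mul_le_mul_of_nonneg_right h1 hl)
          (mul_le_mul_of_nonneg_right (by linarith) hw))
      rw [abs_mul, abs_mul, abs_two, ← sq_abs (θ u - θ' u), ← sq_abs (lam - lam')]
      have h6 := mul_le_mul_of_nonneg_left h5 (mul_nonneg zero_le_two hw)
      nlinarith [mul_nonneg hC0 (sq_nonneg (|θ u - θ' u| - |lam - lam'|)),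
        mul_nonneg hC0 (sq_nonneg |lam - lam'|)]) le_rfl
  linarith [mul_comm (Real.exp (9 * C * |t - s|)) ((θ s - θ' s) ^ 2 + (lam - lam') ^ 2), sq_nonneg (lam - lam'), this]

theorem IsAngle.unique (ha : Continuous a) (hq : Continuous q) (hb : Continuous b)
    (h : IsAngle a q b lam θ) (h' : IsAngle a q b lam θ') {s : ℝ} (hs : θ s = θ' s) :
    θ = θ' := by
  funext t
  obtain ⟨C, -, hC⟩ := exists_sq_sub_le ha hq hb s t
  have := hC lam lam θ θ' h h'
  rw [hs, sub_self, sub_self] at this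
  have h0 : (θ t - θ' t) ^ 2 = 0 := le_antisymm (by linarith) (sq_nonneg _)
  exact sub_eq_zero.1 (pow_eq_zero_iff two_ne_zero |>.1 h0)

theorem IsAngle.lt (ha : Continuous a) (hq : Continuous q) (hb : Continuous b)
    (h : IsAngle a q b lam θ) (h' : IsAngle a q b lam θ') {s : ℝ} (hs : θ s < θ' s) (t : ℝ) :
    θ t < θ' t := by
  by_contra! hcon
  have hc : Continuous fun u => θ u - θ' u := h.continuous.sub h'.continuous
  have := isPreconnected_univ.intermediate_value (mem_univ s) (mem_univ t) hc.continuousOn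
  obtain ⟨u, -, hu⟩ := this (show (0 : ℝ) ∈ Icc _ _ by constructor <;> simp <;> linarith)
  have e := h.unique ha hq hb h' (s := u) (by linarith [show θ u - θ' u = 0 from hu])
  rw [e] at hs
  exact lt_irrefl _ hs

theorem IsAngle.add_int_mul_pi (h : IsAngle a q b lam θ) (m : ℤ) :
    IsAngle a q b lam fun t => θ t + m * Real.pi := by
  intro t
  refine ((h t).add_const (m * Real.pi)).congr_deriv ?_
  unfold angleField
  have e : 2 * (θ t + m * Real.pi) = 2 * θ t + m * (2 * Real.pi) := by ring
  rw [e, Real.cos_add_int_mul_two_pi, Real.sin_add_int_mul_two_pi]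

/-- Time reversal. -/
theorem IsAngle.comp_neg (h : IsAngle a q b lam θ) :
    IsAngle (fun t => -a (-t)) (fun t => -q (-t)) (fun t => -b (-t)) lam fun t => θ (-t) := by
  intro t
  refine ((h (-t)).scomp t (hasDerivAt_neg t)).congr_deriv ?_
  simp [angleField]; ring

/-- A strict sign of the field along the constant level `l` suffices: wherever the solution touches
`l`, its derivative pushes it back. -/
theorem IsAngle.le_of_barrier (h : IsAngle a q b lam θ) {l s t : ℝ}
    (hl : ∀ u, s ≤ u → u ≤ t → angleField a q b lam u l < 0) (hs : θ s ≤ l) (hst : s ≤ t) :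
    θ t ≤ l :=
  image_le_of_deriv_right_lt_deriv_boundary (f' := fun u => angleField a q b lam u (θ u))
    (B := fun _ => l) (B' := fun _ => 0) h.continuous.continuousOn
    (fun u _ => (h u).hasDerivWithinAt) hs (fun u => hasDerivAt_const u l)
    (fun u hu he => by rw [he]; exact hl u hu.1 hu.2.le) (right_mem_Icc.2 hst)

theorem IsAngle.ge_of_barrier (h : IsAngle a q b lam θ) {l s t : ℝ}
    (hl : ∀ u, s ≤ u → u ≤ t → 0 < angleField a q b lam u l) (hs : l ≤ θ s) (hst : s ≤ t) :
    l ≤ θ t :=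
  neg_le_neg_iff.1 <| image_le_of_deriv_right_lt_deriv_boundary
    (f := fun u => -θ u) (f' := fun u => -angleField a q b lam u (θ u))
    (B := fun _ => -l) (B' := fun _ => 0) h.continuous.neg.continuousOn
    (fun u _ => (h u).neg.hasDerivWithinAt) (neg_le_neg hs) (fun u => hasDerivAt_const u (-l))
    (fun u hu he => by rw [neg_inj.1 he]; linarith [hl u hu.1 hu.2.le]) (right_mem_Icc.2 hst)

theorem continuous_angleField (ha : Continuous a) (hq : Continuous q) (hb : Continuous b)
    (lam x : ℝ) : Continuous fun t => angleField a q b lam t x := by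
  unfold angleField; fun_prop

theorem exists_angle_on_ball (ha : Continuous a) (hq : Continuous q) (hb : Continuous b)
    (lam s x : ℝ) (n : ℕ) : ∃ θ : ℝ → ℝ, θ s = x ∧
      ∀ t ∈ Ioo (s - (n + 1)) (s + (n + 1)), HasDerivAt θ (angleField a q b lam t (θ t)) t := by
  obtain ⟨C, hC0, hC⟩ := exists_bound_on_ball ha hq hb s (n + 1)
  have hn : (0 : ℝ) ≤ n := n.cast_nonneg
  have hmem : ∀ t ∈ Icc (s - (n + 1)) (s + (n + 1)), |t - s| ≤ n + 1 := fun t ht => by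
    rw [abs_le]; constructor <;> linarith [ht.1, ht.2]
  have hL : 0 ≤ C * (|lam| + 1) + C + C := by positivity
  -- The field is bounded uniformly in the angle, so a ball of radius bound times `n + 1` cannot be
  -- left, and the solution lives on the whole interval.
  have hp : IsPicardLindelof (angleField a q b lam)
      (⟨s, by constructor <;> linarith⟩ : Icc (s - ((n : ℝ) + 1)) (s + (n + 1))) x
      (⟨(C * (|lam| + 1) + C + C) * (n + 1), by positivity⟩ : NNReal) 0
      (⟨C * (|lam| + 1) + C + C, hL⟩ : NNReal) (⟨4 * C, by positivity⟩ : NNReal) := by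
    refine ⟨fun t ht => ?_, fun y _ => (continuous_angleField ha hq hb lam y).continuousOn,
      fun t ht y _ => ?_, ?_⟩
    · refine LipschitzOnWith.of_dist_le_mul fun y _ z _ => ?_
      obtain ⟨h1, -, h3⟩ := hC t (hmem t ht)
      have := abs_angleField_sub_le a q b lam lam t y z
      rw [sub_self, abs_zero, mul_zero, zero_add] at this
      rw [Real.dist_eq, Real.dist_eq]
      exact this.trans (mul_le_mul_of_nonneg_right (show _ ≤ 4 * C by linarith) (abs_nonneg _))
    · obtain ⟨h1, h2, h3⟩ := hC t (hmem t ht)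
      exact (abs_angleField_le a q b lam t y).trans (add_le_add (add_le_add
        (mul_le_mul_of_nonneg_right h1 (by positivity)) h2) h3)
    · simp only [add_sub_cancel_left, sub_sub_cancel, max_self, NNReal.coe_zero, sub_zero]
      exact le_rfl
  obtain ⟨θ, h0, h⟩ := hp.exists_eq_forall_mem_Icc_hasDerivWithinAt₀
  exact ⟨θ, h0, fun t ht => (h t (Ioo_subset_Icc_self ht)).hasDerivAt (Icc_mem_nhds ht.1 ht.2)⟩

theorem exists_isAngle (ha : Continuous a) (hq : Continuous q) (hb : Continuous b)
    (lam s x : ℝ) : ∃ θ : ℝ → ℝ, θ s = x ∧ IsAngle a q b lam θ := by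
  choose θ h0 h using exists_angle_on_ball ha hq hb lam s x
  have heq : ∀ m n : ℕ, m ≤ n → EqOn (θ m) (θ n) (Ioo (s - (m + 1)) (s + (m + 1))) := by
    intro m n hmn
    have hmn' : (m : ℝ) ≤ n := by exact_mod_cast hmn
    have hm : (0 : ℝ) ≤ m := m.cast_nonneg
    obtain ⟨C, hC0, hC⟩ := exists_bound_on_ball ha hq hb s (m + 1)
    refine ODE_solution_unique_of_mem_Ioo (v := angleField a q b lam) (s := fun _ => univ)
      (K := ⟨4 * C, by positivity⟩) (t₀ := s) (fun t ht => ?_)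
      ⟨by linarith, by linarith⟩ (fun t ht => ⟨h m t ht, mem_univ _⟩)
      (fun t ht => ⟨h n t ⟨by linarith [ht.1], by linarith [ht.2]⟩, mem_univ _⟩)
      ((h0 m).trans (h0 n).symm)
    refine LipschitzOnWith.of_dist_le_mul fun y _ z _ => ?_
    obtain ⟨h1, -, h3⟩ := hC t (by rw [abs_le]; constructor <;> linarith [ht.1, ht.2])
    have := abs_angleField_sub_le a q b lam lam t y z
    rw [sub_self, abs_zero, mul_zero, zero_add] at this
    rw [Real.dist_eq, Real.dist_eq]
    exact this.trans (mul_le_mul_of_nonneg_right (show _ ≤ 4 * C by linarith) (abs_nonneg _))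
  have hfl : ∀ t, |t - s| < ⌊|t - s|⌋₊ + 1 := fun t => Nat.lt_floor_add_one _
  have hmemI : ∀ (t : ℝ) (n : ℕ), |t - s| < n + 1 → t ∈ Ioo (s - ((n : ℝ) + 1)) (s + (n + 1)) := by
    intro t n ht
    rw [abs_lt] at ht
    constructor <;> linarith [ht.1, ht.2]
  have hval : ∀ (t : ℝ) (n : ℕ), |t - s| < n + 1 → θ ⌊|t - s|⌋₊ t = θ n t := by
    intro t n ht
    rcases le_total ⌊|t - s|⌋₊ n with hle | hle
    · exact heq _ _ hle (hmemI t _ (hfl t))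
    · exact (heq _ _ hle (hmemI t _ ht)).symm
  -- Near `t` the floor may jump, but by `hval` the local solutions agree wherever both are defined,
  -- so the glued function coincides there with a single one of them.
  refine ⟨fun t => θ ⌊|t - s|⌋₊ t, by simp [h0], fun t => ?_⟩
  have hev : (fun u => θ ⌊|u - s|⌋₊ u) =ᶠ[𝓝 t] θ ⌊|t - s|⌋₊ := by
    have ho : IsOpen {u : ℝ | |u - s| < ⌊|t - s|⌋₊ + 1} :=
      isOpen_lt (by fun_prop) continuous_const
    filter_upwards [ho.mem_nhds (hfl t)] with u hu using hval u _ hu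
  exact (h _ t (hmemI t _ (hfl t))).congr_of_eventuallyEq hev


/-! ### Solutions trapped near an end of the line -/

/-- A function that is bounded above at `-∞` and decays exponentially wherever it is positive
is nonpositive. -/
theorem nonpos_of_deriv_le_neg_mul {w w' : ℝ → ℝ} {κ C s : ℝ} (hw : ∀ t, HasDerivAt w (w' t) t)
    (hκ : 0 < κ) (hd : ∀ t ≤ s, 0 < w t → w' t ≤ -κ * w t) (hC : ∀ t ≤ s, w t ≤ C) : w s ≤ 0 := by
  by_contra! hpos
  -- Linear growth backward in time already contradicts the bound `C`. The halved rate `κ / 2`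
  -- leaves the strict inequality that the fencing lemma requires.
  have key : ∀ T, 0 ≤ T → w s * (1 + κ / 2 * T) ≤ w (s - T) := by
    intro T hT
    have hdw : ∀ u, HasDerivAt (fun u => -w (s - u)) (w' (s - u)) u := fun u =>
      (((hw (s - u)).scomp u ((hasDerivAt_id u).const_sub s)).neg).congr_deriv (by simp)
    have hB : ∀ u, HasDerivAt (fun u => -(w s * (1 + κ / 2 * u))) (-(w s * (κ / 2))) u := fun u =>
      (((((hasDerivAt_id u).const_mul (κ / 2)).const_add 1).const_mul (w s)).neg).congr_deriv
        (by simp)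
    have := image_le_of_deriv_right_lt_deriv_boundary (f := fun u => -w (s - u))
      (f' := fun u => w' (s - u)) (a := 0) (b := T)
      (continuous_iff_continuousAt.2 fun u => (hdw u).continuousAt).continuousOn
      (fun u _ => (hdw u).hasDerivWithinAt) (by simp) hB
      (fun u hu he => by
        have hwu : w (s - u) = w s * (1 + κ / 2 * u) := neg_inj.1 he
        have hpos' : 0 < w (s - u) := by
          rw [hwu]; have := hu.1; positivity
        have h1 := hd (s - u) (by linarith [hu.1]) hpos'
        have h2 : w s ≤ w (s - u) := by
          rw [hwu]
          have : 0 ≤ w s * (κ / 2 * u) := by have := hu.1; positivity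
          linarith
        nlinarith)
    have := this (right_mem_Icc.2 hT)
    linarith
  have hCs := hC s le_rfl
  have h1 := key (2 * C / (κ * w s)) (by have : 0 < C := by linarith
                                         positivity)
  have h2 := hC (s - 2 * C / (κ * w s)) (by
    have : 0 < C := by linarith
    have : 0 < 2 * C / (κ * w s) := by positivity
    linarith)
  have h3 : w s * (1 + κ / 2 * (2 * C / (κ * w s))) = w s + C := by field_simp
  linarith

/-- The field points into the strip along both edges, so a solution entering at time `s - n` remains
inside up to `s`. The values at `s` of the solutions confined to the strip on `[s - n, s]` thus form
nonempty nested compact sets, and a common point gives the solution. -/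
theorem exists_trapped (ha : Continuous a) (hq : Continuous q) (hb : Continuous b)
    {A B s : ℝ} (hAB : A ≤ B) (hA : ∀ t ≤ s, 0 < angleField a q b lam t A)
    (hB : ∀ t ≤ s, angleField a q b lam t B < 0) :
    ∃ θ, IsAngle a q b lam θ ∧ ∀ t ≤ s, θ t ∈ Icc A B := by
  choose Θ h0 hΘ using fun x => exists_isAngle ha hq hb lam s x
  have hcont : ∀ t, Continuous fun x => Θ x t := by
    intro t
    obtain ⟨C, hC0, hC⟩ := exists_sq_sub_le ha hq hb s t
    have : LipschitzWith ⟨Real.sqrt C, Real.sqrt_nonneg C⟩ fun x => Θ x t := by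
      refine LipschitzWith.of_dist_le_mul fun x y => ?_
      have := hC lam lam _ _ (hΘ x) (hΘ y)
      rw [h0, h0, sub_self, zero_pow two_ne_zero, add_zero] at this
      rw [Real.dist_eq, Real.dist_eq]
      show _ ≤ Real.sqrt C * _
      rw [← Real.sqrt_sq_eq_abs (x - y), ← Real.sqrt_mul hC0]
      exact Real.abs_le_sqrt this
    exact this.continuous
  let S : ℕ → Set ℝ := fun n => {x | ∀ t ∈ Icc (s - n) s, Θ x t ∈ Icc A B}
  have hclosed : ∀ n, IsClosed (S n) := fun n => by
    have : S n = ⋂ t ∈ Icc (s - (n : ℝ)) s, (fun x => Θ x t) ⁻¹' Icc A B := by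
      ext x; simp [S]
    rw [this]
    exact isClosed_biInter fun t _ => isClosed_Icc.preimage (hcont t)
  have hsub : ∀ n, S n ⊆ Icc A B := fun n x hx => by
    have := hx s ⟨by linarith [(n.cast_nonneg : (0 : ℝ) ≤ n)], le_rfl⟩
    rwa [h0] at this
  obtain ⟨x, hx⟩ := IsCompact.nonempty_iInter_of_sequence_nonempty_isCompact_isClosed S
    (fun n x hx t ht => hx t ⟨by push_cast; linarith [ht.1], ht.2⟩)
    (fun n => by
      obtain ⟨θ, hθ0, hθ⟩ := exists_isAngle ha hq hb lam (s - n) A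
      have e : Θ (θ s) = θ := (hΘ (θ s)).unique ha hq hb hθ (h0 _)
      refine ⟨θ s, fun t ht => ?_⟩
      rw [e]
      exact ⟨hθ.ge_of_barrier (fun u _ hu => hA u (hu.trans ht.2)) hθ0.ge ht.1,
        hθ.le_of_barrier (fun u _ hu => hB u (hu.trans ht.2)) (hθ0.le.trans hAB) ht.1⟩)
    (isCompact_Icc.of_isClosed_subset (hclosed 0) (hsub 0)) hclosed
  refine ⟨Θ x, hΘ x, fun t ht => ?_⟩
  obtain ⟨n, hn⟩ := exists_nat_ge (s - t)
  exact mem_iInter.1 hx n t ⟨by linarith, ht⟩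

/-- Hypothesis `hc` says that the excess of the gap between two trapped angles over `M * |lam -
lam'|`, where positive, decays at rate `κ`. Being bounded at `-∞`, the excess cannot be positive at
`s`. So the trapped angle is Lipschitz in `lam` at `s`, and continuous dependence carries this to
every time. -/
theorem exists_trapped_family (ha : Continuous a) (hq : Continuous q) (hb : Continuous b)
    {A B s κ M : ℝ} {Λ : Set ℝ} (hAB : A ≤ B) (hκ : 0 < κ) (hM : 0 ≤ M)
    (hA : ∀ t ≤ s, ∀ lam ∈ Λ, 0 < angleField a q b lam t A)
    (hB : ∀ t ≤ s, ∀ lam ∈ Λ, angleField a q b lam t B < 0)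
    (hc : ∀ t ≤ s, ∀ lam ∈ Λ, ∀ lam' ∈ Λ, ∀ x ∈ Icc A B, ∀ y ∈ Icc A B,
      M * |lam - lam'| ≤ y - x → angleField a q b lam t y - angleField a q b lam' t x ≤
        -κ * (y - x - M * |lam - lam'|)) :
    ∃ θ : ℝ → ℝ → ℝ, (∀ lam ∈ Λ, IsAngle a q b lam (θ lam) ∧ ∀ t ≤ s, θ lam t ∈ Icc A B) ∧
      ∀ t, ContinuousOn (fun lam => θ lam t) Λ := by
  have hex : ∀ lam, ∃ θ, lam ∈ Λ → IsAngle a q b lam θ ∧ ∀ t ≤ s, θ t ∈ Icc A B := by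
    intro lam
    by_cases hl : lam ∈ Λ
    · obtain ⟨θ, hθ⟩ := exists_trapped ha hq hb hAB (fun t ht => hA t ht lam hl)
        (fun t ht => hB t ht lam hl)
      exact ⟨θ, fun _ => hθ⟩
    · exact ⟨0, fun h => absurd h hl⟩
  choose θ hθ using hex
  have hle : ∀ lam ∈ Λ, ∀ lam' ∈ Λ, θ lam s - θ lam' s ≤ M * |lam - lam'| := by
    intro lam hl lam' hl'
    obtain ⟨h1, h1'⟩ := hθ lam hl
    obtain ⟨h2, h2'⟩ := hθ lam' hl'
    have := nonpos_of_deriv_le_neg_mul (w := fun t => θ lam t - θ lam' t - M * |lam - lam'|)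
      (w' := fun t => angleField a q b lam t (θ lam t) - angleField a q b lam' t (θ lam' t))
      (C := B - A) (s := s)
      (fun t => ((h1 t).sub (h2 t)).sub_const _) hκ
      (fun t ht hpos => hc t ht lam hl lam' hl' _ (h2' t ht) _ (h1' t ht) (by linarith))
      (fun t ht => by
        have := mul_nonneg hM (abs_nonneg (lam - lam'))
        linarith [(h1' t ht).2, (h2' t ht).1])
    linarith
  refine ⟨θ, hθ, fun t => ?_⟩
  obtain ⟨C, hC0, hC⟩ := exists_sq_sub_le ha hq hb s t
  have hL : LipschitzOnWith ⟨Real.sqrt (C * (M ^ 2 + 1)), Real.sqrt_nonneg _⟩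
      (fun lam => θ lam t) Λ := by
    refine LipschitzOnWith.of_dist_le_mul fun x hx y hy => ?_
    have h1 := hC x y _ _ (hθ x hx).1 (hθ y hy).1
    have h2 : |θ x s - θ y s| ≤ M * |x - y| :=
      abs_le.2 ⟨by have := hle y hy x hx; rw [abs_sub_comm] at this; linarith, hle x hx y hy⟩
    have h3 : (θ x s - θ y s) ^ 2 ≤ M ^ 2 * (x - y) ^ 2 := by
      rw [← sq_abs (θ x s - θ y s), ← sq_abs (x - y), ← mul_pow]
      exact pow_le_pow_left₀ (abs_nonneg _) h2 2
    rw [Real.dist_eq, Real.dist_eq]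
    show _ ≤ Real.sqrt (C * (M ^ 2 + 1)) * _
    rw [← Real.sqrt_sq_eq_abs (x - y), ← Real.sqrt_mul (by positivity)]
    refine Real.abs_le_sqrt (h1.trans ?_)
    rw [mul_assoc]
    exact mul_le_mul_of_nonneg_left (by linarith) hC0
  exact hL.continuousOn

theorem exists_trapped_family_atTop (ha : Continuous a) (hq : Continuous q) (hb : Continuous b)
    {A B s κ M : ℝ} {Λ : Set ℝ} (hAB : A ≤ B) (hκ : 0 < κ) (hM : 0 ≤ M)
    (hA : ∀ t, s ≤ t → ∀ lam ∈ Λ, angleField a q b lam t A < 0)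
    (hB : ∀ t, s ≤ t → ∀ lam ∈ Λ, 0 < angleField a q b lam t B)
    (hc : ∀ t, s ≤ t → ∀ lam ∈ Λ, ∀ lam' ∈ Λ, ∀ x ∈ Icc A B, ∀ y ∈ Icc A B,
      M * |lam - lam'| ≤ y - x → κ * (y - x - M * |lam - lam'|) ≤
        angleField a q b lam t y - angleField a q b lam' t x) :
    ∃ θ : ℝ → ℝ → ℝ, (∀ lam ∈ Λ, IsAngle a q b lam (θ lam) ∧ ∀ t, s ≤ t → θ lam t ∈ Icc A B) ∧
      ∀ t, ContinuousOn (fun lam => θ lam t) Λ := by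
  have hrev : ∀ lam t x, angleField (fun t => -a (-t)) (fun t => -q (-t)) (fun t => -b (-t))
      lam t x = -angleField a q b lam (-t) x := fun lam t x => by
    unfold angleField; ring
  obtain ⟨θ, h1, h2⟩ := exists_trapped_family (a := fun t => -a (-t)) (q := fun t => -q (-t))
    (b := fun t => -b (-t)) (s := -s) (Λ := Λ) (by fun_prop) (by fun_prop) (by fun_prop) hAB hκ hM
    (fun t ht lam hl => by rw [hrev]; linarith [hA (-t) (by linarith) lam hl])
    (fun t ht lam hl => by rw [hrev]; linarith [hB (-t) (by linarith) lam hl])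
    (fun t ht lam hl lam' hl' x hx y hy h => by
      rw [hrev, hrev]; linarith [hc (-t) (by linarith) lam hl lam' hl' x hx y hy h])
  refine ⟨fun lam t => θ lam (-t), fun lam hl => ⟨?_, fun t ht => ?_⟩, fun t => h2 (-t)⟩
  · simpa using (h1 lam hl).1.comp_neg
  · exact (h1 lam hl).2 (-t) (by linarith)


/-! ### Angles connecting the two distinguished directions -/

theorem cos_le_cos_of_abs_le {φ u : ℝ} (hφ : φ ≤ Real.pi) (hu : |u| ≤ φ) :
    Real.cos φ ≤ Real.cos u := by
  rw [← Real.cos_abs u]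
  exact Real.cos_le_cos_of_nonneg_of_le_pi (abs_nonneg u) hφ hu

theorem cos_mul_sub_le_sin_sub_sin {φ x y : ℝ} (hφ : φ ≤ Real.pi) (hx : -φ ≤ x) (hxy : x ≤ y)
    (hy : y ≤ φ) : Real.cos φ * (y - x) ≤ Real.sin y - Real.sin x := by
  refine (convex_Icc (-φ) φ).mul_sub_le_image_sub_of_le_deriv Real.continuous_sin.continuousOn
    Real.differentiable_sin.differentiableOn (fun u hu => ?_) x ⟨hx, hxy.trans hy⟩ y
    ⟨hx.trans hxy, hy⟩ hxy
  rw [interior_Icc] at hu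
  rw [Real.deriv_sin]
  exact cos_le_cos_of_abs_le hφ (abs_le.2 ⟨hu.1.le, hu.2.le⟩)

theorem abs_cos_two_mul_sub_le {x y : ℝ} (hxy : x ≤ y) :
    |Real.cos (2 * y) - Real.cos (2 * x)| ≤ 2 * (y - x) := by
  refine (Real.abs_cos_sub_cos_le _ _).trans_eq ?_
  rw [abs_of_nonneg (by linarith)]; ring

/-- The family of angles of the solutions that are regular at the origin. -/
theorem exists_left_family (hq : Continuous q) (hb : Continuous b) (hqpos : ∀ t, 0 < q t)
    {σ s β : ℝ} (hσ : σ = 1 ∨ σ = -1) (hs0 : 0 ≤ s) (hs : s < 1) (hβ : 0 < β)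
    (h : ∀ᶠ t in atBot, β ≤ σ * b t ∧ q t ≤ s * (σ * b t)) :
    ∃ θ : ℝ → ℝ → ℝ, (∀ lam ∈ Ioo (-1 : ℝ) 1, IsAngle Real.exp q b lam (θ lam) ∧
      (∀ t, -Real.pi ≤ θ lam t) ∧ ∀ᶠ t in atBot, 0 < b t * Real.cos (2 * θ lam t)) ∧
      ∀ t, ContinuousOn (fun lam => θ lam t) (Ioo (-1) 1) := by
  -- The attracting direction is near `0` when `b > 0` and near `π / 2` when `b < 0`; shifting by
  -- `c` treats both signs at once.
  obtain ⟨c, hc0, hcos, hsin⟩ : ∃ c : ℝ, 0 ≤ c ∧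
      (∀ x, Real.cos (2 * (c + x)) = σ * Real.cos (2 * x)) ∧
      (∀ x, Real.sin (2 * (c + x)) = σ * Real.sin (2 * x)) := by
    rcases hσ with rfl | rfl
    · exact ⟨0, le_rfl, by simp, by simp⟩
    · refine ⟨Real.pi / 2, by positivity, fun x => ?_, fun x => ?_⟩
      · rw [show 2 * (Real.pi / 2 + x) = 2 * x + Real.pi by ring, Real.cos_add_pi]; ring
      · rw [show 2 * (Real.pi / 2 + x) = 2 * x + Real.pi by ring, Real.sin_add_pi]; ring
  have hF : ∀ lam t x, angleField Real.exp q b lam t (c + x) =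
      Real.exp t * (lam + σ * Real.cos (2 * x)) + q t - σ * b t * Real.sin (2 * x) := by
    intro lam t x
    rw [angleField, hcos, hsin]; ring
  -- The midpoint of `s` and `1`: since `sin φ > s`, the term `σ b sin φ` beats `q` with a margin of
  -- at least `β (1 - s) / 2`, which absorbs the terms in `exp t`; since `φ < π / 2`, the sine is
  -- strictly increasing across the strip.
  set φ := Real.arcsin ((1 + s) / 2) with hφ
  have hsinφ : Real.sin φ = (1 + s) / 2 := Real.sin_arcsin (by linarith) (by linarith)
  have hφ0 : 0 < φ := Real.arcsin_pos.2 (by linarith)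
  have hφ1 : φ < Real.pi / 2 := Real.arcsin_lt_pi_div_two.2 (by linarith)
  have hcosφ : 0 < Real.cos φ := Real.cos_pos_of_mem_Ioo ⟨by linarith, hφ1⟩
  have hexp : ∀ {ε : ℝ}, 0 < ε → ∀ᶠ t in atBot, Real.exp t < ε := fun {ε} hε =>
    Real.tendsto_exp_atBot.eventually_lt_const hε
  obtain ⟨T, hT⟩ := eventually_atBot.1 (h.and ((hexp (ε := β * (1 - s) / 4) (by
    have : 0 < 1 - s := by linarith
    positivity)).and (hexp (ε := β * Real.cos φ / 2) (by positivity))))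
  have hσc : ∀ x, |σ * Real.cos x| ≤ 1 := fun x => by
    rcases hσ with rfl | rfl <;> simp [Real.abs_cos_le_one]
  have hσa : |σ| = 1 := by rcases hσ with rfl | rfl <;> simp
  obtain ⟨θ, h1, h2⟩ := exists_trapped_family (a := Real.exp) (q := q) (b := b)
    (A := c + -(φ / 2)) (B := c + φ / 2) (s := T) (κ := β * Real.cos φ) (M := 1)
    (Λ := Ioo (-1) 1) Real.continuous_exp hq hb (by linarith) (by positivity) zero_le_one
    (fun t ht lam hl => by
      obtain ⟨⟨hb1, hb2⟩, he1, he2⟩ := hT t ht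
      rw [hF, show 2 * -(φ / 2) = -φ by ring, Real.sin_neg, hsinφ]
      have h3 := (abs_le.1 (hσc (-φ))).1
      have h4 : Real.exp t * -2 ≤ Real.exp t * (lam + σ * Real.cos (-φ)) :=
        mul_le_mul_of_nonneg_left (by linarith [hl.1]) (Real.exp_pos t).le
      nlinarith [hqpos t])
    (fun t ht lam hl => by
      obtain ⟨⟨hb1, hb2⟩, he1, he2⟩ := hT t ht
      rw [hF, show 2 * (φ / 2) = φ by ring, hsinφ]
      have h3 := (abs_le.1 (hσc φ)).2
      have h4 : Real.exp t * (lam + σ * Real.cos φ) ≤ Real.exp t * 2 :=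
        mul_le_mul_of_nonneg_left (by linarith [hl.2]) (Real.exp_pos t).le
      nlinarith)
    (fun t ht lam hl lam' hl' x hx y hy hxy => by
      obtain ⟨⟨hb1, hb2⟩, he1, he2⟩ := hT t ht
      have habs := abs_nonneg (lam - lam')
      obtain ⟨x, rfl⟩ : ∃ x', x = c + x' := ⟨x - c, by ring⟩
      obtain ⟨y, rfl⟩ : ∃ y', y = c + y' := ⟨y - c, by ring⟩
      have hxy' : x ≤ y := by linarith
      have hs1 := cos_mul_sub_le_sin_sub_sin (φ := φ) (x := 2 * x) (y := 2 * y) (by linarith)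
        (by linarith [hx.1]) (by linarith) (by linarith [hy.2])
      have hc1 : |σ * (Real.cos (2 * y) - Real.cos (2 * x))| ≤ 2 * (y - x) := by
        rw [abs_mul, hσa, one_mul]; exact abs_cos_two_mul_sub_le hxy'
      have hc2 := (abs_le.1 hc1).2
      rw [hF, hF]
      have he := Real.exp_pos t
      have h5 : Real.exp t * (lam - lam' + σ * (Real.cos (2 * y) - Real.cos (2 * x))) ≤
          Real.exp t * (|lam - lam'| + 2 * (y - x)) :=
        mul_le_mul_of_nonneg_left (by linarith [le_abs_self (lam - lam')]) he.le
      have h6 : β * (Real.cos φ * (2 * y - 2 * x)) ≤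
          σ * b t * (Real.sin (2 * y) - Real.sin (2 * x)) :=
        mul_le_mul hb1 hs1 (mul_nonneg hcosφ.le (by linarith)) (by linarith)
      have h7 : Real.exp t * (|lam - lam'| + 2 * (y - x)) ≤
          β * Real.cos φ / 2 * (|lam - lam'| + 2 * (y - x)) :=
        mul_le_mul_of_nonneg_right he2.le (by linarith)
      have h8 : 0 ≤ β * Real.cos φ * |lam - lam'| := by positivity
      nlinarith)
  refine ⟨θ, fun lam hl => ⟨(h1 lam hl).1, fun t => ?_, ?_⟩, h2⟩
  · have hlow : -Real.pi ≤ θ lam (min t T) := by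
      have := ((h1 lam hl).2 (min t T) (min_le_right _ _)).1
      linarith
    refine (h1 lam hl).1.ge_of_barrier (fun u _ _ => ?_) hlow (min_le_left _ _)
    rw [angleField, show 2 * -Real.pi = -(2 * Real.pi) by ring, Real.cos_neg, Real.sin_neg,
      Real.cos_two_pi, Real.sin_two_pi]
    have := mul_pos (Real.exp_pos u) (show 0 < lam + 1 by linarith [hl.1])
    linarith [hqpos u]
  · filter_upwards [eventually_le_atBot T] with t ht
    obtain ⟨⟨hb1, -⟩, -⟩ := hT t ht
    have hm := (h1 lam hl).2 t ht
    have e : Real.cos (2 * θ lam t) = σ * Real.cos (2 * (θ lam t - c)) := by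
      rw [← hcos]; congr 1; ring
    have hpos : 0 < Real.cos (2 * (θ lam t - c)) :=
      hcosφ.trans_le (cos_le_cos_of_abs_le (by linarith)
        (abs_le.2 ⟨by linarith [hm.1], by linarith [hm.2]⟩))
    rw [e]
    rcases hσ with rfl | rfl
    · exact mul_pos (by linarith) (by linarith)
    · exact mul_pos_of_neg_of_neg (by linarith) (by linarith)

/-- The family of angles of the solutions that decay at infinity. -/
theorem exists_right_family (hq : Continuous q) (hb : Continuous b) (hqpos : ∀ t, 0 < q t)
    {M l₁ l₂ : ℝ} (hM : ∀ᶠ t in atTop, |b t| ≤ M)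
    (hlim : Tendsto (fun t => q t * Real.exp (-t)) atTop (𝓝 0)) (h1 : -1 < l₁) (h2 : l₂ < 1) :
    ∃ θ : ℝ → ℝ → ℝ, (∀ lam ∈ Icc l₁ l₂, IsAngle Real.exp q b lam (θ lam) ∧
      (∀ t, θ lam t ≤ 0) ∧ (∃ η > 0, ∀ᶠ t in atTop, Real.sin (2 * θ lam t) ≤ -η) ∧
      (∀ᶠ t in atTop, -(Real.pi / 2) < θ lam t)) ∧
      ∀ t, ContinuousOn (fun lam => θ lam t) (Icc l₁ l₂) := by
  -- Centring at `-π / 4` turns the dominant term into `exp t * (lam + sin 2x)`, which increases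
  -- with `x` near `0`.
  have hcos : ∀ x, Real.cos (2 * (-(Real.pi / 4) + x)) = Real.sin (2 * x) := fun x => by
    rw [show 2 * (-(Real.pi / 4) + x) = 2 * x - Real.pi / 2 by ring, Real.cos_sub_pi_div_two]
  have hsin : ∀ x, Real.sin (2 * (-(Real.pi / 4) + x)) = -Real.cos (2 * x) := fun x => by
    rw [show 2 * (-(Real.pi / 4) + x) = 2 * x - Real.pi / 2 by ring, Real.sin_sub_pi_div_two]
  have hF : ∀ lam t x, angleField Real.exp q b lam t (-(Real.pi / 4) + x) =
      Real.exp t * (lam + Real.sin (2 * x)) + q t + b t * Real.cos (2 * x) := by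
    intro lam t x
    rw [angleField, hcos, hsin]; ring
  obtain ⟨m, hm0, hm1, hml, hmr⟩ : ∃ m : ℝ, 0 ≤ m ∧ m < 1 ∧ -m ≤ l₁ ∧ l₂ ≤ m :=
    ⟨max 0 (max (-l₁) l₂), le_max_left _ _, by simp; constructor <;> linarith,
      by linarith [le_max_left (-l₁) l₂, le_max_right 0 (max (-l₁) l₂)],
      by linarith [le_max_right (-l₁) l₂, le_max_right 0 (max (-l₁) l₂)]⟩
  -- As `|lam| ≤ m < sin φ`, the dominant term has size at least `exp t * (1 - m) / 2` on both
  -- edges, with opposite signs.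
  set φ := Real.arcsin ((1 + m) / 2) with hφ
  have hsinφ : Real.sin φ = (1 + m) / 2 := Real.sin_arcsin (by linarith) (by linarith)
  have hφ0 : 0 < φ := Real.arcsin_pos.2 (by linarith)
  have hφ1 : φ < Real.pi / 2 := Real.arcsin_lt_pi_div_two.2 (by linarith)
  have hcosφ : 0 < Real.cos φ := Real.cos_pos_of_mem_Ioo ⟨by linarith, hφ1⟩
  have hMlim : Tendsto (fun t => M * Real.exp (-t)) atTop (𝓝 0) := by
    simpa using Real.tendsto_exp_neg_atTop_nhds_zero.const_mul M
  have hlim2 : Tendsto (fun t => q t * Real.exp (-t) + M * Real.exp (-t)) atTop (𝓝 0) := by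
    simpa using hlim.add hMlim
  obtain ⟨T, hT⟩ := eventually_atTop.1 (hM.and
    ((hlim2.eventually_lt_const (show 0 < (1 - m) / 2 by linarith)).and
    ((hMlim.eventually_lt_const (show 0 < Real.cos φ / 2 by linarith)).and
    (eventually_ge_atTop 0))))
  have hmulexp : ∀ t c d : ℝ, c * Real.exp (-t) < d → c < Real.exp t * d := fun t c d h => by
    have h' := mul_lt_mul_of_pos_left h (Real.exp_pos t)
    rwa [show Real.exp t * (c * Real.exp (-t)) = c * (Real.exp t * Real.exp (-t)) by ring,
      ← Real.exp_add, add_neg_cancel, Real.exp_zero, mul_one] at h'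
  obtain ⟨θ, h3, h4⟩ := exists_trapped_family_atTop (a := Real.exp) (q := q) (b := b)
    (A := -(Real.pi / 4) + -(φ / 2)) (B := -(Real.pi / 4) + φ / 2) (s := T) (κ := Real.cos φ)
    (M := 1 / Real.cos φ) (Λ := Icc l₁ l₂) Real.continuous_exp hq hb (by linarith) hcosφ
    (by positivity)
    (fun t ht lam hl => by
      obtain ⟨hb1, hb2, hb3, ht0⟩ := hT t ht
      have e1 := hmulexp t (q t + M) _ (by rw [add_mul]; exact hb2)
      rw [hF, show 2 * -(φ / 2) = -φ by ring, Real.sin_neg, Real.cos_neg, hsinφ]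
      have h5 : b t * Real.cos φ ≤ M := (le_abs_self _).trans (by
        rw [abs_mul]
        exact (mul_le_of_le_one_right (abs_nonneg _) (Real.abs_cos_le_one φ)).trans hb1)
      have h6 : Real.exp t * (lam + -((1 + m) / 2)) ≤ Real.exp t * (-((1 - m) / 2)) :=
        mul_le_mul_of_nonneg_left (by linarith [hl.2]) (Real.exp_pos t).le
      linarith)
    (fun t ht lam hl => by
      obtain ⟨hb1, hb2, hb3, ht0⟩ := hT t ht
      have e1 := hmulexp t (q t + M) _ (by rw [add_mul]; exact hb2)
      rw [hF, show 2 * (φ / 2) = φ by ring, hsinφ]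
      have h5 : -M ≤ b t * Real.cos φ := (abs_le.1 (by
        rw [abs_mul]
        exact (mul_le_of_le_one_right (abs_nonneg _) (Real.abs_cos_le_one φ)).trans hb1)).1
      have h6 : Real.exp t * ((1 - m) / 2) ≤ Real.exp t * (lam + (1 + m) / 2) :=
        mul_le_mul_of_nonneg_left (by linarith [hl.1]) (Real.exp_pos t).le
      linarith [hqpos t])
    (fun t ht lam hl lam' hl' x hx y hy hxy => by
      obtain ⟨hb1, hb2, hb3, ht0⟩ := hT t ht
      have e1 := hmulexp t M _ hb3
      have habs := abs_nonneg (lam - lam')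
      have hxy0 : 0 ≤ 1 / Real.cos φ * |lam - lam'| := by positivity
      obtain ⟨x, rfl⟩ : ∃ x', x = -(Real.pi / 4) + x' := ⟨x + Real.pi / 4, by ring⟩
      obtain ⟨y, rfl⟩ : ∃ y', y = -(Real.pi / 4) + y' := ⟨y + Real.pi / 4, by ring⟩
      have hxy' : x ≤ y := by linarith
      have hs1 := cos_mul_sub_le_sin_sub_sin (φ := φ) (x := 2 * x) (y := 2 * y) (by linarith)
        (by linarith [hx.1]) (by linarith) (by linarith [hy.2])
      have hc1 := abs_cos_two_mul_sub_le hxy'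
      rw [hF, hF]
      have he := Real.exp_pos t
      have h5 : Real.exp t * (-|lam - lam'| + 2 * (Real.cos φ * (y - x))) ≤
          Real.exp t * (lam - lam' + (Real.sin (2 * y) - Real.sin (2 * x))) :=
        mul_le_mul_of_nonneg_left (by linarith [neg_abs_le (lam - lam')]) he.le
      have h6 : -(Real.exp t * (Real.cos φ / 2) * (2 * (y - x))) ≤
          b t * (Real.cos (2 * y) - Real.cos (2 * x)) := (abs_le.1 (by
        rw [abs_mul]
        exact mul_le_mul (hb1.trans e1.le) hc1 (abs_nonneg _) (by positivity))).1
      have h7 : Real.cos φ * (y - x - 1 / Real.cos φ * |lam - lam'|) =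
          Real.cos φ * (y - x) - |lam - lam'| := by field_simp
      have h8 : 0 ≤ Real.cos φ * (y - x - 1 / Real.cos φ * |lam - lam'|) :=
        mul_nonneg hcosφ.le (by linarith)
      have h9 := mul_le_mul_of_nonneg_right (Real.one_le_exp ht0) h8
      rw [show -(Real.pi / 4) + y - (-(Real.pi / 4) + x) = y - x by ring]
      rw [one_mul] at h9
      refine h9.trans ?_
      rw [h7]
      linarith)
  have hpi := Real.pi_pos
  refine ⟨θ, fun lam hl => ⟨(h3 lam hl).1, fun t => ?_, ⟨Real.cos φ, hcosφ, ?_⟩, ?_⟩, h4⟩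
  -- The level `0` can only be crossed upward, so a positive value would persist, whereas the strip
  -- eventually containing the angle lies below `0`.
  · by_contra! hpos
    have hbar := (h3 lam hl).1.ge_of_barrier (l := 0) (s := t) (t := max t T) (fun u _ _ => by
      rw [angleField, mul_zero, Real.cos_zero, Real.sin_zero]
      have := mul_pos (Real.exp_pos u) (show 0 < lam + 1 by linarith [hl.1])
      linarith [hqpos u]) hpos.le (le_max_left _ _)
    linarith [((h3 lam hl).2 (max t T) (le_max_right _ _)).2]
  · filter_upwards [eventually_ge_atTop T] with t ht
    have hm := (h3 lam hl).2 t ht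
    rw [show θ lam t = -(Real.pi / 4) + (θ lam t + Real.pi / 4) by ring, hsin]
    exact neg_le_neg (cos_le_cos_of_abs_le (by linarith)
        (abs_le.2 ⟨by linarith [hm.1], by linarith [hm.2]⟩))
  · filter_upwards [eventually_ge_atTop T] with t ht
    linarith [((h3 lam hl).2 t ht).1]

/-- At the threshold `lam = 1` the angular velocity is eventually bounded below. -/
theorem exists_pos_le_angleField_one {M g : ℝ} (hg : 0 < g)
    (h : ∀ᶠ t in atTop, |b t| ≤ M ∧ g ≤ q t) :
    ∀ᶠ t in atTop, ∀ x, g / 2 ≤ angleField Real.exp q b 1 t x := by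
  have hlarge : ∀ᶠ t in atTop, M ^ 2 / g < Real.exp t :=
    Real.tendsto_exp_atTop.eventually_gt_atTop _
  filter_upwards [h, hlarge] with t ⟨h1, h2⟩ h3 x
  have he := Real.exp_pos t
  rw [div_lt_iff₀ hg] at h3
  rw [angleField, Real.cos_two_mul, Real.sin_two_mul]
  set C := Real.cos x
  set S := Real.sin x
  have hS : S ^ 2 ≤ 1 := Real.sin_sq_le_one x
  have hb2 : (b t) ^ 2 ≤ M ^ 2 := by
    rw [← sq_abs (b t)]; exact pow_le_pow_left₀ (abs_nonneg _) h1 2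
  -- At `lam = 1` the field is `2 exp t C ^ 2 - 2 b S C + q`; completing the square bounds it below
  -- by `g - M ^ 2 / (2 exp t)`.
  have h4 : (b t) ^ 2 * S ^ 2 ≤ M ^ 2 := (mul_le_of_le_one_right (sq_nonneg _) hS).trans hb2
  have h5 : 0 ≤ (2 * Real.exp t * C - b t * S) ^ 2 := sq_nonneg _
  have h6 : 0 ≤ Real.exp t * (4 * Real.exp t * C ^ 2 - 4 * b t * S * C + g) := by nlinarith
  have h7 := nonneg_of_mul_nonneg_right h6 he
  nlinarith

theorem IsAngle.add_mul_le {a : ℝ → ℝ} {lam : ℝ} {θ : ℝ → ℝ} (h : IsAngle a q b lam θ) {c s t : ℝ}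
    (hst : s ≤ t) (hc : ∀ u ∈ Icc s t, c ≤ angleField a q b lam u (θ u)) :
    θ s + c * (t - s) ≤ θ t := by
  have := (convex_Icc s t).mul_sub_le_image_sub_of_le_deriv (C := c) h.continuous.continuousOn
    (fun u _ => (h u).differentiableAt.differentiableWithinAt) (fun u hu => by
      rw [(h u).deriv]; exact hc u (interior_subset hu)) s (left_mem_Icc.2 hst) t
      (right_mem_Icc.2 hst) hst
  linarith

/-- A shooting argument: the left and right angles are compared at a time `T`, and their difference
passes through `m * π` as `lam` runs from `l` to some `l' < 1`. -/
theorem exists_connecting_angle (hq : Continuous q) (hb : Continuous b) (hqpos : ∀ t, 0 < q t)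
    {σ s β : ℝ} (hσ : σ = 1 ∨ σ = -1) (hs0 : 0 ≤ s) (hs : s < 1) (hβ : 0 < β)
    (h0 : ∀ᶠ t in atBot, β ≤ σ * b t ∧ q t ≤ s * (σ * b t))
    {M g : ℝ} (hg : 0 < g) (hinf : ∀ᶠ t in atTop, |b t| ≤ M ∧ g ≤ q t)
    (hlim : Tendsto (fun t => q t * Real.exp (-t)) atTop (𝓝 0))
    {l : ℝ} (hl : l ∈ Ioo (-1 : ℝ) 1) :
    ∃ lam ∈ Ico l 1, ∃ θ, IsAngle Real.exp q b lam θ ∧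
      (∀ᶠ t in atBot, 0 < b t * Real.cos (2 * θ t)) ∧
      ∃ η > 0, ∀ᶠ t in atTop, Real.sin (2 * θ t) ≤ -η := by
  obtain ⟨θ, hθ, hθc⟩ := exists_left_family hq hb hqpos hσ hs0 hs hβ h0
  obtain ⟨T, hT⟩ := eventually_atTop.1 ((exists_pos_le_angleField_one hg hinf).and
    (hlim.eventually_lt_const (show 0 < 1 - l by linarith [hl.2])))
  have hpi := Real.pi_pos
  -- `m` has to be fixed before `l'`, hence before the right family on `[l, l']` exists. The bound
  -- `ψ l T ≥ -π / 2`, which holds for any such family, makes this possible.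
  obtain ⟨m, hm⟩ := exists_nat_ge ((θ l T + Real.pi / 2) / Real.pi)
  rw [div_le_iff₀ hpi] at hm
  obtain ⟨N, hN0, hN⟩ : ∃ N : ℝ, 0 ≤ N ∧ m * Real.pi < -Real.pi + g / 4 * N := by
    refine ⟨(m * Real.pi + Real.pi + 1) / (g / 4), by positivity, ?_⟩
    rw [mul_div_cancel₀ _ (by positivity)]; linarith
  -- On `[T, T + N]` moving from `1` to `l'` costs at most `g / 4` of the speed `g / 2`; by the
  -- choice of `N` the remainder carries the angle from `-π` beyond `m * π`.
  obtain ⟨l', hl1, hl2, hl3⟩ : ∃ l', l < l' ∧ l' < 1 ∧ Real.exp (T + N) * (1 - l') ≤ g / 4 := by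
    have he := Real.exp_pos (T + N)
    refine ⟨max ((1 + l) / 2) (1 - g / 4 / Real.exp (T + N)),
      lt_max_of_lt_left (by linarith [hl.2]),
      max_lt (by linarith [hl.2]) (by have : 0 < g / 4 / Real.exp (T + N) := by positivity
                                      linarith), ?_⟩
    rw [mul_comm, ← le_div_iff₀ he]
    linarith [le_max_right ((1 + l) / 2) (1 - g / 4 / Real.exp (T + N))]
  obtain ⟨ψ, hψ, hψc⟩ := exists_right_family hq hb hqpos (hinf.mono fun t h => h.1) hlim hl.1 hl2
  have hsub : Icc l l' ⊆ Ioo (-1) 1 := fun x hx =>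
    ⟨hl.1.trans_le hx.1, hx.2.trans_lt hl2⟩
  -- After `T` the level `-π / 2` can only be crossed downward, since the field there is `exp u * (l
  -- - 1) + q u < 0`; as `ψ` is eventually above it, it is above it at `T`.
  have hleft : θ l T - ψ l T ≤ m * Real.pi := by
    obtain ⟨ha, -, -, hev⟩ := hψ l (left_mem_Icc.2 hl1.le)
    have : -(Real.pi / 2) ≤ ψ l T := by
      by_contra! hcon
      obtain ⟨t, ht1, ht2⟩ := (hev.and (eventually_ge_atTop T)).exists
      have := ha.le_of_barrier (l := -(Real.pi / 2)) (s := T) (t := t) (fun u hu _ => by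
        rw [angleField, show 2 * -(Real.pi / 2) = -Real.pi by ring, Real.cos_neg, Real.sin_neg,
          Real.cos_pi, Real.sin_pi]
        have h' := mul_lt_mul_of_pos_left (hT u hu).2 (Real.exp_pos u)
        rw [show Real.exp u * (q u * Real.exp (-u)) = q u * (Real.exp u * Real.exp (-u)) by ring,
          ← Real.exp_add, add_neg_cancel, Real.exp_zero, mul_one] at h'
        linarith) hcon.le ht2
      linarith
    linarith
  -- Otherwise `θ` would stay below `ψ + m * π ≤ m * π`, contradicting the rotation accumulated by
  -- time `T + N`.
  have hright : m * Real.pi ≤ θ l' T - ψ l' T := by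
    by_contra! hcon
    have hmem : l' ∈ Icc l l' := right_mem_Icc.2 hl1.le
    obtain ⟨ha, hneg, -, -⟩ := hψ l' hmem
    obtain ⟨ha', hlow, -⟩ := hθ l' (hsub hmem)
    have h1 := ha'.lt Real.continuous_exp hq hb (ha.add_int_mul_pi m) (s := T)
      (by push_cast; linarith) (T + N)
    have h2 := ha'.add_mul_le (c := g / 4) (s := T) (t := T + N) (by linarith) (fun u hu => by
      have e : angleField Real.exp q b l' u (θ l' u) =
          angleField Real.exp q b 1 u (θ l' u) - Real.exp u * (1 - l') := by
        unfold angleField; ring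
      have h3 := (hT u hu.1).1 (θ l' u)
      have h4 := mul_le_mul_of_nonneg_right (Real.exp_le_exp.2 hu.2)
        (show 0 ≤ 1 - l' by linarith)
      linarith)
    rw [add_sub_cancel_left] at h2
    push_cast at h1
    linarith [hlow T, hneg (T + N)]
  obtain ⟨lam, hlam, he⟩ := intermediate_value_Icc hl1.le
    (((hθc T).mono hsub).sub (hψc T)) (show (m : ℝ) * Real.pi ∈ Icc _ _ from ⟨hleft, hright⟩)
  obtain ⟨ha, -, ⟨η, hη, hs⟩, -⟩ := hψ lam hlam
  obtain ⟨ha', -, hbot⟩ := hθ lam (hsub hlam)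
  have heq := ha'.unique Real.continuous_exp hq hb (ha.add_int_mul_pi m) (s := T)
    (by push_cast; simp only [Pi.sub_apply] at he; linarith)
  refine ⟨lam, ⟨hlam.1, hlam.2.trans_lt hl2⟩, θ lam, ha', hbot, η, hη, ?_⟩
  filter_upwards [hs] with t ht
  rw [heq, show 2 * (ψ lam t + (m : ℤ) * Real.pi) = 2 * ψ lam t + (m : ℤ) * (2 * Real.pi) by ring,
    Real.sin_add_int_mul_two_pi]
  exact ht


/-! ### From the angle to the eigenfunction -/

theorem isLocAC_of_contDiffOn {u : ℝ → ℝ} (h : ContDiffOn ℝ 1 u (Ioi 0)) : IsLocAC u := by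
  intro x y hx hxy
  refine (h.mono ?_).absolutelyContinuousOnInterval
  rw [uIcc_of_le hxy]
  exact fun z hz => hx.trans_le hz.1

theorem isEigenvalue_A0 {P : ℝ → Matrix (Fin 2) (Fin 2) ℝ} {lam : ℝ} {u v : ℝ → ℝ}
    (hu : ContDiffOn ℝ 1 u (Ioi 0)) (hv : ContDiffOn ℝ 1 v (Ioi 0))
    (hL : IntegrableOn (fun x => u x ^ 2 + v x ^ 2) (Ioi 0))
    (h0 : ∀ x ∈ Ioi (0 : ℝ), tau P u v x = lam • pair u v x)
    (hne : ∃ x ∈ Ioi (0 : ℝ), u x ≠ 0 ∨ v x ≠ 0) :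
    IsEigenvalue (A0 P) lam := by
  have hmeas : AEStronglyMeasurable (pair u v) halfLine := by
    have h1 : ContinuousOn (fun x => ![u x, v x]) (Ioi 0) := continuousOn_pi.2 fun i => by
      fin_cases i
      · exact hu.continuousOn
      · exact hv.continuousOn
    exact ((PiLp.continuous_toLp 2 _).comp_continuousOn h1).aestronglyMeasurable measurableSet_Ioi
  have hmem : MemLp (pair u v) 2 halfLine := by
    rw [memLp_two_iff_integrable_sq_norm hmeas]
    refine hL.congr (Eventually.of_forall fun x => ?_)
    simp [pair, EuclideanSpace.norm_sq_eq]
  have hac_u := isLocAC_of_contDiffOn hu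
  have hac_v := isLocAC_of_contDiffOn hv
  have hgraph : (hmem.toLp, lam • hmem.toLp) ∈ (A0 P).graph := by
    rw [A0_graph]
    refine ⟨u, v, hac_u, hac_v, hmem.coeFn_toLp, ?_⟩
    filter_upwards [Lp.coeFn_smul lam hmem.toLp, hmem.coeFn_toLp,
      ae_restrict_mem measurableSet_Ioi] with x h1 h2 hx
    rw [h1, Pi.smul_apply, h2, h0 x hx]
  obtain ⟨f, hf1, hf2⟩ := (LinearPMap.mem_graph_iff _).1 hgraph
  refine ⟨f, fun hzero => ?_, by rw [hf2, hf1]⟩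
  rw [hf1] at hzero
  have hae : pair u v =ᵐ[halfLine] 0 := by
    have h1 := hmem.coeFn_toLp
    rw [show hmem.toLp = 0 from hzero] at h1
    exact h1.symm.trans (Lp.coeFn_zero _ _ _)
  obtain ⟨x, hx, hx'⟩ := hne
  rcases hx' with hx' | hx'
  · exact hx' (eqOn_zero_of_ae hac_u (hae.mono fun y hy => by
      simpa [pair] using congrArg (fun w : EuclideanSpace ℝ (Fin 2) => w 0) hy) x hx)
  · exact hx' (eqOn_zero_of_ae hac_v (hae.mono fun y hy => by
      simpa [pair] using congrArg (fun w : EuclideanSpace ℝ (Fin 2) => w 1) hy) x hx)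

theorem IsAngle.contDiff {a : ℝ → ℝ} {lam : ℝ} {θ : ℝ → ℝ} (ha : Continuous a) (hq : Continuous q)
    (hb : Continuous b) (h : IsAngle a q b lam θ) : ContDiff ℝ 1 θ := by
  rw [contDiff_one_iff_deriv]
  refine ⟨fun t => (h t).differentiableAt, ?_⟩
  rw [show deriv θ = fun t => angleField a q b lam t (θ t) from funext fun t => (h t).deriv]
  have := h.continuous
  unfold angleField
  fun_prop

/-- Square integrability, in the variable `x = exp t`, of a solution with amplitude `exp ∘ ℓ`. -/
theorem integrableOn_sq_amplitude {ℓ θ : ℝ → ℝ} {M η : ℝ} (hη : 0 < η)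
    (hd : ∀ t, HasDerivAt ℓ (b t * Real.cos (2 * θ t) + Real.exp t * Real.sin (2 * θ t)) t)
    (h0 : ∀ᶠ t in atBot, 0 < b t * Real.cos (2 * θ t))
    (hM : ∀ᶠ t in atTop, |b t| ≤ M) (hs : ∀ᶠ t in atTop, Real.sin (2 * θ t) ≤ -η) :
    IntegrableOn (fun x => Real.exp (ℓ (Real.log x)) ^ 2) (Ioi 0) := by
  have hℓ : Continuous ℓ := continuous_iff_continuousAt.2 fun t => (hd t).continuousAt
  have hcont : ContinuousOn (fun x => Real.exp (ℓ (Real.log x)) ^ 2) (Ioi 0) :=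
    ((Real.continuous_exp.comp hℓ).comp_continuousOn
      (Real.continuousOn_log.mono fun x (hx : 0 < x) => hx.ne')).pow 2
  obtain ⟨S, hS⟩ := eventually_atBot.1 h0
  obtain ⟨T, hT⟩ := eventually_atTop.1 ((hM.and hs).and
    (Real.tendsto_exp_atTop.eventually_ge_atTop (2 * M / η)))
  -- Here `ℓ' ≥ -exp t`, which is integrable at `-∞`, so the amplitude is bounded near `x = 0`.
  have hleft : ∀ t ≤ S, ℓ t ≤ ℓ S + Real.exp S := by
    intro t ht
    have hd' : ∀ u, HasDerivAt (fun u => ℓ u + Real.exp u) _ u := fun u =>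
      (hd u).add (Real.hasDerivAt_exp u)
    have := monotoneOn_of_deriv_nonneg (f := fun u => ℓ u + Real.exp u) (convex_Iic S)
      (hℓ.add Real.continuous_exp).continuousOn
      (fun u _ => (hd' u).differentiableAt.differentiableWithinAt) (fun u hu => by
        rw [(hd' u).deriv]
        have h1 := hS u (show u ∈ Iic S from interior_subset hu)
        have h2 := mul_nonneg (Real.exp_pos u).le
          (show 0 ≤ Real.sin (2 * θ u) + 1 by linarith [Real.neg_one_le_sin (2 * θ u)])
        linarith) ht (mem_Iic.2 le_rfl) ht
    linarith [Real.exp_pos t]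
  -- Past `T` one has `M ≤ (η / 2) * exp t`, so half of the decay rate `η` survives the term in `b`;
  -- the squared amplitude is then at most a constant times `exp (-η x)`.
  have hright : ∀ t, T ≤ t → ℓ t ≤ ℓ T + η / 2 * Real.exp T - η / 2 * Real.exp t := by
    intro t ht
    have hd' : ∀ u, HasDerivAt (fun u => ℓ u + η / 2 * Real.exp u) _ u := fun u =>
      (hd u).add ((Real.hasDerivAt_exp u).const_mul (η / 2))
    have := antitoneOn_of_deriv_nonpos (f := fun u => ℓ u + η / 2 * Real.exp u)
      (convex_Ici T)
      (hℓ.add (continuous_const.mul Real.continuous_exp)).continuousOn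
      (fun u _ => (hd' u).differentiableAt.differentiableWithinAt) (fun u hu => by
        rw [(hd' u).deriv]
        obtain ⟨⟨h1, h2⟩, h3⟩ := hT u (show u ∈ Ici T from interior_subset hu)
        rw [div_le_iff₀ hη] at h3
        have h4 : b u * Real.cos (2 * θ u) ≤ M := (le_abs_self _).trans (by
          rw [abs_mul]
          exact (mul_le_of_le_one_right (abs_nonneg _) (Real.abs_cos_le_one _)).trans h1)
        have h5 := mul_le_mul_of_nonneg_left h2 (Real.exp_pos u).le
        linarith) (mem_Ici.2 le_rfl) ht ht
    linarith
  have hI1 : IntegrableOn (fun x => Real.exp (ℓ (Real.log x)) ^ 2) (Ioc 0 (Real.exp S)) := by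
    refine IntegrableOn.of_bound measure_Ioc_lt_top
      ((hcont.mono Ioc_subset_Ioi_self).aestronglyMeasurable measurableSet_Ioc)
      (Real.exp (ℓ S + Real.exp S) ^ 2) ?_
    filter_upwards [ae_restrict_mem measurableSet_Ioc] with x hx
    rw [Real.norm_eq_abs, abs_of_nonneg (sq_nonneg _)]
    exact pow_le_pow_left₀ (Real.exp_pos _).le (Real.exp_le_exp.2 (hleft _
      ((Real.log_le_iff_le_exp hx.1).2 hx.2))) 2
  have hI2 : IntegrableOn (fun x => Real.exp (ℓ (Real.log x)) ^ 2)
      (Icc (Real.exp S) (Real.exp T)) :=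
    (hcont.mono fun x hx => (Real.exp_pos S).trans_le hx.1).integrableOn_Icc
  have hI3 : IntegrableOn (fun x => Real.exp (ℓ (Real.log x)) ^ 2) (Ioi (Real.exp T)) := by
    refine Integrable.mono' ((exp_neg_integrableOn_Ioi (Real.exp T) hη).const_mul
      (Real.exp (ℓ T + η / 2 * Real.exp T) ^ 2))
      ((hcont.mono fun x (hx : _ < x) => (Real.exp_pos T).trans hx).aestronglyMeasurable
        measurableSet_Ioi) ?_
    filter_upwards [ae_restrict_mem measurableSet_Ioi] with x hx
    have hx0 : 0 < x := (Real.exp_pos T).trans hx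
    have h1 := hright _ ((Real.le_log_iff_exp_le hx0).2 (le_of_lt hx))
    rw [Real.exp_log hx0] at h1
    rw [Real.norm_eq_abs, abs_of_nonneg (sq_nonneg _), ← Real.exp_nat_mul, ← Real.exp_nat_mul,
      ← Real.exp_add]
    refine Real.exp_le_exp.2 ?_
    push_cast
    linarith
  refine ((hI1.union hI2).union hI3).mono_set fun x (hx : 0 < x) => ?_
  rcases le_or_gt x (Real.exp S) with h | h
  · exact Or.inl (Or.inl ⟨hx, h⟩)
  · rcases le_or_gt x (Real.exp T) with h' | h'
    · exact Or.inl (Or.inr ⟨h.le, h'⟩)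
    · exact Or.inr h'

theorem isEigenvalue_of_isAngle {V : ℝ → ℝ} {k : ℤ} {μ lam M η : ℝ} {θ : ℝ → ℝ}
    (hq : Continuous q) (hb : Continuous b)
    (hqV : ∀ t, q t = -(Real.exp t * V (Real.exp t)))
    (hbV : ∀ t, b t = -k - μ * (Real.exp t * deriv V (Real.exp t)))
    (h : IsAngle Real.exp q b lam θ) (h0 : ∀ᶠ t in atBot, 0 < b t * Real.cos (2 * θ t))
    (hM : ∀ᶠ t in atTop, |b t| ≤ M) (hη : 0 < η)
    (hs : ∀ᶠ t in atTop, Real.sin (2 * θ t) ≤ -η) :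
    IsEigenvalue (A0 (diracMatrix V k μ)) lam := by
  have hθ := h.continuous
  have hcont : Continuous fun t =>
      b t * Real.cos (2 * θ t) + Real.exp t * Real.sin (2 * θ t) := by fun_prop
  obtain ⟨ℓ, hℓ⟩ : ∃ ℓ : ℝ → ℝ, ∀ t, HasDerivAt ℓ
      (b t * Real.cos (2 * θ t) + Real.exp t * Real.sin (2 * θ t)) t :=
    ⟨_, fun t => (hcont.integral_hasStrictDerivAt 0 t).hasDerivAt⟩
  have hℓ1 : ContDiff ℝ 1 ℓ := by
    rw [contDiff_one_iff_deriv]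
    exact ⟨fun t => (hℓ t).differentiableAt, by rwa [show deriv ℓ = _ from
      funext fun t => (hℓ t).deriv]⟩
  have hθ1 := h.contDiff Real.continuous_exp hq hb
  have hlog : ContDiffOn ℝ 1 Real.log (Ioi 0) :=
    Real.contDiffOn_log.mono fun x (hx : 0 < x) => hx.ne'
  have hr1 := Real.contDiff_exp.comp_contDiffOn (hℓ1.comp_contDiffOn hlog)
  have hu1 := hr1.mul (Real.contDiff_cos.comp_contDiffOn (hθ1.comp_contDiffOn hlog))
  have hv1 := hr1.mul (Real.contDiff_sin.comp_contDiffOn (hθ1.comp_contDiffOn hlog))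
  have hlogd : ∀ {f : ℝ → ℝ} {f' x : ℝ}, 0 < x → HasDerivAt f f' (Real.log x) →
      HasDerivAt (fun x => f (Real.log x)) (f' * x⁻¹) x := fun hx hf =>
    hf.comp _ (Real.hasDerivAt_log hx.ne')
  have hdu : ∀ x, 0 < x → HasDerivAt
      (fun x => Real.exp (ℓ (Real.log x)) * Real.cos (θ (Real.log x))) _ x := fun x hx =>
    (hlogd hx (hℓ _)).exp.mul (hlogd hx (h _)).cos
  have hdv : ∀ x, 0 < x → HasDerivAt
      (fun x => Real.exp (ℓ (Real.log x)) * Real.sin (θ (Real.log x))) _ x := fun x hx =>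
    (hlogd hx (hℓ _)).exp.mul (hlogd hx (h _)).sin
  refine isEigenvalue_A0 (u := fun x => Real.exp (ℓ (Real.log x)) * Real.cos (θ (Real.log x)))
    (v := fun x => Real.exp (ℓ (Real.log x)) * Real.sin (θ (Real.log x))) hu1 hv1 ?_ ?_ ?_
  · refine (integrableOn_sq_amplitude hη hℓ h0 hM hs).congr_fun (fun x _ => ?_) measurableSet_Ioi
    simp only
    rw [mul_pow, mul_pow, ← mul_add, Real.cos_sq_add_sin_sq, mul_one]
  · intro x hx
    have hx0 : 0 < x := hx
    have hx' := hx0.ne'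
    have hq' : q (Real.log x) = -(x * V x) := by rw [hqV, Real.exp_log hx0]
    have hb' : b (Real.log x) = -k - μ * (x * deriv V x) := by rw [hbV, Real.exp_log hx0]
    have hsc := Real.sin_sq_add_cos_sq (θ (Real.log x))
    ext i
    fin_cases i
    · show tau _ _ _ x 0 = _
      rw [tau_zero, (hdv x hx0).deriv]
      simp only [diracMatrix, pair, Matrix.of_apply, Matrix.cons_val_zero, Matrix.cons_val_one,
        Matrix.cons_val', angleField, hq', hb', Real.exp_log hx0, PiLp.smul_apply, smul_eq_mul,
        Real.cos_two_mul, Real.sin_two_mul, Fin.zero_eta]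
      set C := Real.cos (θ (Real.log x))
      set S := Real.sin (θ (Real.log x))
      have hS : S ^ 2 = 1 - C ^ 2 := by linarith
      field_simp
      ring_nf
      simp only [hS]
      ring
    · show tau _ _ _ x 1 = _
      rw [tau_one, (hdu x hx0).deriv]
      simp only [diracMatrix, pair, Matrix.of_apply, Matrix.cons_val_zero, Matrix.cons_val_one,
        Matrix.cons_val', angleField, hq', hb', Real.exp_log hx0, PiLp.smul_apply, smul_eq_mul,
        Real.cos_two_mul, Real.sin_two_mul, Fin.mk_one]
      set C := Real.cos (θ (Real.log x))
      set S := Real.sin (θ (Real.log x))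
      have hS : S ^ 2 = 1 - C ^ 2 := by linarith
      field_simp
      ring_nf
      simp only [hS]
      ring
  · refine ⟨1, mem_Ioi.2 one_pos, ?_⟩
    by_contra! hcon
    have he := (Real.exp_pos (ℓ (Real.log 1))).ne'
    have h1 := (mul_eq_zero.1 hcon.1).resolve_left he
    have h2 := (mul_eq_zero.1 hcon.2).resolve_left he
    have := Real.sin_sq_add_cos_sq (θ (Real.log 1))
    rw [h1, h2] at this
    norm_num at this


/-! ### Asymptotics of the potential -/

theorem tendsto_rpow_mul_of_remainder {V : ℝ → ℝ} {γ α : ℝ} {l : Filter ℝ}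
    (hl : ∀ᶠ x in l, 0 < x) (h : Tendsto (fun x => x ^ α * remainder V γ α x) l (𝓝 0)) :
    Tendsto (fun x => x ^ α * V x) l (𝓝 γ) := by
  have := h.add_const γ
  rw [zero_add] at this
  refine this.congr' ?_
  filter_upwards [hl] with x hx
  have := (Real.rpow_pos_of_pos hx α).ne'
  rw [remainder]
  field_simp
  ring

theorem tendsto_rpow_mul_deriv_of_remainder {V : ℝ → ℝ} {γ α : ℝ} {l : Filter ℝ}
    (hV : ∀ x, 0 < x → DifferentiableAt ℝ V x) (hl : ∀ᶠ x in l, 0 < x)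
    (h : Tendsto (fun x => x ^ (α + 1) * deriv (remainder V γ α) x) l (𝓝 0)) :
    Tendsto (fun x => x ^ (α + 1) * deriv V x) l (𝓝 (-(γ * α))) := by
  have := h.add_const (-(γ * α))
  rw [zero_add] at this
  refine this.congr' ?_
  filter_upwards [hl] with x hx
  have hd : HasDerivAt (remainder V γ α) (deriv V x - γ * (-α * x ^ (-α - 1))) x := by
    have h1 := (hV x hx).hasDerivAt.sub
      ((Real.hasDerivAt_rpow_const (p := -α) (Or.inl hx.ne')).const_mul γ)
    refine h1.congr_of_eventuallyEq ?_
    filter_upwards [lt_mem_nhds hx] with y hy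
    simp [remainder, Real.rpow_neg hy.le, div_eq_mul_inv]
  rw [hd.deriv]
  have e : x ^ (α + 1) * x ^ (-α - 1) = 1 := by
    rw [← Real.rpow_add hx, show α + 1 + (-α - 1) = 0 by ring, Real.rpow_zero]
  linear_combination γ * α * e

/-- For `μ = 0`, `b` is the constant `-k` and `q → -γ` with `|γ| < |k|`. For `μ ≠ 0`, `x ^ α * b`
tends to `μ γ α ≠ 0` while `x ^ α * q` tends to `0`, so the magnetic term dominates whatever the
sizes of `k` and `γ`. -/
theorem exists_eventually_bounds_at_zero {V : ℝ → ℝ} {k : ℤ} {μ γ α : ℝ} (hk : k ≠ 0)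
    (hV : ∀ x, 0 < x → DifferentiableAt ℝ V x) (h : ConditionAtZero V k μ γ α) :
    ∃ σ s β : ℝ, (σ = 1 ∨ σ = -1) ∧ 0 ≤ s ∧ s < 1 ∧ 0 < β ∧ ∀ᶠ x in 𝓝[>] (0 : ℝ),
      β ≤ σ * (-k - μ * (x * deriv V x)) ∧
        -(x * V x) ≤ s * (σ * (-k - μ * (x * deriv V x))) := by
  obtain ⟨hα, h1, h2⟩ := h
  have hpos : ∀ᶠ x in 𝓝[>] (0 : ℝ), 0 < x := self_mem_nhdsWithin
  rcases eq_or_ne μ 0 with rfl | hμ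
  · obtain ⟨rfl, hlim, -, hγ⟩ := h1 rfl
    have hlim' := tendsto_rpow_mul_of_remainder hpos (α := 1) (by simpa using hlim)
    have hk0 : (0 : ℝ) < |(k : ℝ)| := abs_pos.2 (by exact_mod_cast hk)
    have hγk : |γ| < |(k : ℝ)| := sq_lt_sq.1 (by linarith)
    obtain ⟨σ, hσ, hσk⟩ : ∃ σ : ℝ, (σ = 1 ∨ σ = -1) ∧ σ * -(k : ℝ) = |(k : ℝ)| := by
      rcases le_total 0 (k : ℝ) with hk' | hk'
      · exact ⟨-1, Or.inr rfl, by rw [abs_of_nonneg hk']; ring⟩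
      · exact ⟨1, Or.inl rfl, by rw [abs_of_nonpos hk']; ring⟩
    -- The ratio `s` comes from the midpoint of `|γ|` and `|k|`, leaving room for the convergence of
    -- `x V`.
    refine ⟨σ, (|γ| + |(k : ℝ)|) / 2 / |(k : ℝ)|, |(k : ℝ)|, hσ, by positivity,
      by rw [div_lt_one hk0]; linarith, hk0, ?_⟩
    filter_upwards [hlim'.eventually_const_lt (show -((|γ| + |(k : ℝ)|) / 2) < γ by
      linarith [neg_abs_le γ])] with x hx
    rw [Real.rpow_one] at hx
    rw [zero_mul, sub_zero, hσk, div_mul_cancel₀ _ hk0.ne']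
    exact ⟨le_rfl, by linarith⟩
  · obtain ⟨hlim, hlim', -, hγ⟩ := h2 hμ
    have hl1 := tendsto_rpow_mul_of_remainder hpos hlim
    have hl2 := tendsto_rpow_mul_deriv_of_remainder hV hpos hlim'
    have hx0 : Tendsto (fun x : ℝ => x) (𝓝[>] 0) (𝓝 0) := tendsto_id.mono_left nhdsWithin_le_nhds
    have hxα : Tendsto (fun x : ℝ => x ^ α) (𝓝[>] 0) (𝓝 0) := by
      have := (Real.continuousAt_rpow_const 0 α (Or.inr hα.le)).tendsto
      rw [Real.zero_rpow hα.ne'] at this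
      exact this.mono_left nhdsWithin_le_nhds
    obtain ⟨σ, hσ, hσd⟩ : ∃ σ : ℝ, (σ = 1 ∨ σ = -1) ∧ 0 < σ * (μ * (γ * α)) := by
      have hne : μ * (γ * α) ≠ 0 := mul_ne_zero hμ (mul_ne_zero hγ hα.ne')
      rcases hne.lt_or_gt with h' | h'
      · exact ⟨-1, Or.inr rfl, by linarith⟩
      · exact ⟨1, Or.inl rfl, by linarith⟩
    set d := σ * (μ * (γ * α))
    have hb : Tendsto (fun x => σ * (-k * x ^ α - μ * (x ^ (α + 1) * deriv V x))) (𝓝[>] 0)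
        (𝓝 d) := by
      have := ((hxα.const_mul (-(k : ℝ))).sub (hl2.const_mul μ)).const_mul σ
      convert this using 2
      simp only [d]; ring
    have hq : Tendsto (fun x => -(x * (x ^ α * V x))) (𝓝[>] 0) (𝓝 0) := by
      simpa using (hx0.mul hl1).neg
    refine ⟨σ, 1 / 2, d / 2, hσ, by norm_num, by norm_num, by positivity, ?_⟩
    filter_upwards [hpos, hb.eventually_const_lt (show d / 2 < d by linarith),
      hq.eventually_lt_const (show 0 < d / 4 by positivity),
      hxα.eventually_lt_const one_pos] with x hx h3 h4 h5
    have hp := Real.rpow_pos_of_pos hx α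
    rw [Real.rpow_add_one hx.ne'] at h3
    have e : σ * (-k * x ^ α - μ * (x ^ α * x * deriv V x)) =
        x ^ α * (σ * (-k - μ * (x * deriv V x))) := by ring
    rw [e] at h3
    set Y := σ * (-k - μ * (x * deriv V x))
    have hY : 0 < Y := by
      by_contra! hY
      have := mul_nonpos_of_nonneg_of_nonpos hp.le hY
      linarith
    constructor
    · nlinarith
    · have h6 : x ^ α * -(x * V x) < x ^ α * (1 / 2 * Y) := by linarith
      exact (lt_of_mul_lt_mul_left h6 hp.le).le

/-- The last bound is where slow decay enters: `α ≤ 1` gives `x ≥ x ^ α` for `x ≥ 1`, so `-x V` is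
at least `-x ^ α V`, which tends to `-γ > 0`. -/
theorem eventually_bounds_at_top {V : ℝ → ℝ} {γ α : ℝ}
    (hV : ∀ x, 0 < x → DifferentiableAt ℝ V x) (hγ : γ < 0) (hα : α ≤ 1)
    (h : ConditionAtInfinity V γ α) :
    Tendsto V atTop (𝓝 0) ∧ Tendsto (fun x => x * deriv V x) atTop (𝓝 0) ∧
      ∀ᶠ x in atTop, -γ / 2 ≤ -(x * V x) := by
  obtain ⟨hα0, h1, h2⟩ := h
  have hpos : ∀ᶠ x : ℝ in atTop, 0 < x := eventually_gt_atTop 0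
  have hl1 := tendsto_rpow_mul_of_remainder hpos h1
  have hl2 := tendsto_rpow_mul_deriv_of_remainder hV hpos h2
  have hneg := tendsto_rpow_neg_atTop hα0
  refine ⟨?_, ?_, ?_⟩
  · have := hneg.mul hl1
    rw [zero_mul] at this
    refine this.congr' ?_
    filter_upwards [hpos] with x hx
    rw [← mul_assoc, ← Real.rpow_add hx, neg_add_cancel, Real.rpow_zero, one_mul]
  · have := hneg.mul hl2
    rw [zero_mul] at this
    refine this.congr' ?_
    filter_upwards [hpos] with x hx
    rw [← mul_assoc, ← Real.rpow_add hx, neg_add_cancel_left, Real.rpow_one]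
  · filter_upwards [hl1.eventually_lt_const (show γ < γ / 2 by linarith),
      eventually_ge_atTop 1] with x hx hx1
    have hp := Real.rpow_pos_of_pos (zero_lt_one.trans_le hx1) α
    have hle : x ^ α ≤ x := by
      simpa using Real.rpow_le_rpow_of_exponent_le hx1 hα
    have hVneg : V x < 0 := by
      by_contra! hcon
      have := mul_nonneg hp.le hcon
      linarith
    have := mul_le_mul_of_nonpos_right hle hVneg.le
    linarith

end RadialDirac

/-! ### The eigenvalues accumulating at `1` -/

theorem proposition3p7 (V : ℝ → ℝ) (k : ℤ) (μ γinf αinf γ0 α0 : ℝ)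
    (hk : k ≠ 0)
    (hV : ContDiffOn ℝ 1 V (Set.Ioi 0))
    (hVmono : StrictMonoOn V (Set.Ioi 0))
    (hVneg : ∀ x : ℝ, 0 < x → V x < 0)
    (hγinf : γinf < 0) (hαinf : αinf ∈ Set.Ioc (0 : ℝ) 1)
    (hinf : RadialDirac.ConditionAtInfinity V γinf αinf)
    (hzero : RadialDirac.ConditionAtZero V k μ γ0 α0) :
    ∃ lam : ℕ → ℝ,
      (∀ n, lam n ∈ Set.Ioo (-1 : ℝ) 1 ∧
        RadialDirac.IsEigenvalue (RadialDirac.A0 (RadialDirac.diracMatrix V k μ)) (lam n)) ∧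
      Filter.Tendsto lam Filter.atTop (nhds 1) := by
  have hVd : ∀ x, 0 < x → DifferentiableAt ℝ V x := fun x hx =>
    (hV.differentiableOn one_ne_zero).differentiableAt (Ioi_mem_nhds hx)
  have hq : Continuous fun t => -(Real.exp t * V (Real.exp t)) :=
    (Real.continuous_exp.mul (hV.continuousOn.comp_continuous Real.continuous_exp
      Real.exp_pos)).neg
  have hb : Continuous fun t => -(k : ℝ) - μ * (Real.exp t * deriv V (Real.exp t)) :=
    continuous_const.sub (continuous_const.mul (Real.continuous_exp.mul
      ((hV.continuousOn_deriv_of_isOpen isOpen_Ioi le_rfl).comp_continuous Real.continuous_exp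
        Real.exp_pos)))
  obtain ⟨σ, s, β, hσ, hs0, hs1, hβ, h0⟩ :=
    RadialDirac.exists_eventually_bounds_at_zero hk hVd hzero
  obtain ⟨hlim, hlim', hg⟩ := RadialDirac.eventually_bounds_at_top hVd hγinf hαinf.2 hinf
  have hM : ∀ᶠ x in atTop, |-(k : ℝ) - μ * (x * deriv V x)| ≤ |(k : ℝ)| + 1 := by
    have h1 : Tendsto (fun x => |-(k : ℝ) - μ * (x * deriv V x)|) atTop (𝓝 |(k : ℝ)|) := by
      have := (tendsto_const_nhds (x := -(k : ℝ))).sub (hlim'.const_mul μ)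
      simpa using this.abs
    exact (h1.eventually_lt_const (lt_add_one _)).mono fun x hx => hx.le
  have key : ∀ l ∈ Ioo (-1 : ℝ) 1, ∃ lam ∈ Ico l 1,
      RadialDirac.IsEigenvalue (RadialDirac.A0 (RadialDirac.diracMatrix V k μ)) lam := by
    intro l hl
    obtain ⟨lam, hlam, θ, hθ, hbot, η, hη, htop⟩ :=
      RadialDirac.exists_connecting_angle hq hb
        (fun t => neg_pos.2 (mul_neg_of_pos_of_neg (Real.exp_pos t) (hVneg _ (Real.exp_pos t))))
        hσ hs0 hs1 hβ (Real.tendsto_exp_atBot_nhdsGT.eventually h0)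
        (show 0 < -γinf / 2 by linarith) (Real.tendsto_exp_atTop.eventually (hM.and hg))
        (by
          have := (hlim.comp Real.tendsto_exp_atTop).neg
          rw [neg_zero] at this
          refine this.congr fun t => ?_
          have e : Real.exp t * Real.exp (-t) = 1 := by rw [← Real.exp_add]; simp
          simp only [Function.comp_apply]
          linear_combination V (Real.exp t) * e) hl
    exact ⟨lam, hlam, RadialDirac.isEigenvalue_of_isAngle hq hb (fun _ => rfl) (fun _ => rfl) hθ
      hbot (Real.tendsto_exp_atTop.eventually hM) hη htop⟩
  -- One eigenvalue is picked in each `[1 - 1 / (n + 1), 1)`; as all are below `1`, convergence to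
  -- `1` forces infinitely many distinct values.
  have hl : ∀ n : ℕ, 1 - 1 / ((n : ℝ) + 1) ∈ Ioo (-1 : ℝ) 1 := fun n => by
    have h1 : 0 < 1 / ((n : ℝ) + 1) := by positivity
    have h2 : 1 / ((n : ℝ) + 1) ≤ 1 := by
      rw [div_le_one (by positivity)]; linarith [(n.cast_nonneg : (0 : ℝ) ≤ n)]
    constructor <;> linarith
  choose lam hlam heig using fun n : ℕ => key _ (hl n)
  refine ⟨lam, fun n => ⟨⟨(hl n).1.trans_le (hlam n).1, (hlam n).2⟩, heig n⟩, ?_⟩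
  refine tendsto_of_tendsto_of_tendsto_of_le_of_le ?_ tendsto_const_nhds (fun n => (hlam n).1)
    (fun n => (hlam n).2.le)
  simpa using (tendsto_const_nhds (x := (1 : ℝ))).sub tendsto_one_div_add_atTop_nhds_zero_nat
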